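/- Let $\mathcal Q_2$ be the 2-adic ring $C^*$-algebra, i.e. the universal $C^*$-algebra generated by a unitary $U$ and an isometry $S_2$ with $S_2U=U^2S_2$ and $S_2S_2^*+US_2S_2^*U^*=1$, and view the Cuntz algebra $\mathcal O_2$ as included in $\mathcal Q_2$ with generating isometries $S_1=US_2$ and $S_2$. Let $\rho:\mathcal Q_2\to\mathcal B(\mathcal H)$ be a permutative representation: $\mathcal H$ has an orthonormal basis $\{e_n\}_{n\in\mathbb N}$, fixed from now on, such that $\rho(S_2)e_n=e_{\sigma_2(n)}$ and $\rho(U)e_n=e_{\tau(n)}$ for all $n$, where $\sigma_2:\mathbb N\to\mathbb N$ is an injection and $\tau$ is a bijection of $\mathbb N$. Put $\sigma_1=\tau\circ\sigma_2$, so that $\rho(S_i)e_n=e_{\sigma_i(n)}$ for $i=1,2$. The coding map $\sigma:\mathbb N\to\{1,2\}^{\mathbb N}$ sends $n$ to the unique sequence $(i_1,i_2,\dots)$ such that $n$ lies in the range of $\sigma_{i_1}\circ\cdots\circ\sigma_{i_k}$ for every $k\ge 1$. The restriction $\rho|_{\mathcal O_2}$ is called regular (in the sense of Bratteli–Jorgensen)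 if, for all $n$ and all $i_1,\dots,i_k\in\{1,2\}$, $\sigma(n)=\sigma(\sigma_{i_1}\circ\cdots\circ\sigma_{i_k}(n))$ implies $n=\sigma_{i_1}\circ\cdots\circ\sigma_{i_k}(n)$; it is called multiplicity-free if $\sigma$ is injective. A permutative subrepresentation of $\rho$ is the restriction of $\rho$ to a $\rho(\mathcal Q_2)$-invariant subspace of the form $\overline{\mathrm{span}}\{e_i: i\in I\}$ with $I\subset\mathbb N$. Then: (a) $\rho|_{\mathcal O_2}$ is regular if and only if $\rho$ is the (Hilbert space) direct sum of irreducible permutative subrepresentations; (b) $\rho|_{\mathcal O_2}$ is multiplicity-free if and only if $\rho$ is the direct sum of pairwise unitarily inequivalent irreducible permutative subrepresentations. -/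

import Mathlib

open scoped ENNReal

universe u v w

/-! ## Universal C*-algebras on two generators -/

namespace UniversalCStar

/-- A nonzero unital C*-algebra with a pair of contractions satisfying the relations `R`.
(The zero algebra contributes nothing to the universal norm.) -/
structure Model (R : ∀ (A : Type u) [CStarAlgebra A], A → A → Prop) : Type (u + 1) where
  carrier : Type u
  [cstar : CStarAlgebra carrier]
  [nontriv : Nontrivial carrier]
  x : carrier
  y : carrier
  rel : R carrier x y
  norm_x : ‖x‖ ≤ 1
  norm_y : ‖y‖ ≤ 1

attribute [instance] Model.cstar Model.nontriv

variable (R : ∀ (A : Type u) [CStarAlgebra A], A → A → Prop)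

/-- The C*-algebra of bounded families indexed by all models. -/
abbrev Ambient : Type (u + 1) := lp (fun m : Model R => m.carrier) ∞

noncomputable instance : CStarAlgebra (Ambient R) where

/-- The family of first generators. -/
def ambX : Ambient R :=
  ⟨fun m => m.x, memℓp_infty ⟨1, by rintro _ ⟨m, rfl⟩; exact m.norm_x⟩⟩

/-- The family of second generators. -/
def ambY : Ambient R :=
  ⟨fun m => m.y, memℓp_infty ⟨1, by rintro _ ⟨m, rfl⟩; exact m.norm_y⟩⟩

/-- The C*-subalgebra generated by the two universal families. -/
noncomputable abbrev sub : StarSubalgebra ℂ (Ambient R) :=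
  (StarAlgebra.adjoin ℂ {ambX R, ambY R}).topologicalClosure

/-- The universal unital C*-algebra generated by two contractions subject to `R`. (A C*-algebra
generated by two elements is separable, hence has a copy in every universe, so the universe of the
models is immaterial.) -/
def Alg : Type (u + 1) := sub R

noncomputable instance : CStarAlgebra (Alg R) :=
  StarSubalgebra.cstarAlgebra (sub R)
    (h_closed := StarSubalgebra.isClosed_topologicalClosure _)

theorem ambX_mem : ambX R ∈ sub R :=
  StarSubalgebra.le_topologicalClosure _ (StarAlgebra.subset_adjoin ℂ _ (by simp))

theorem ambY_mem : ambY R ∈ sub R :=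
  StarSubalgebra.le_topologicalClosure _ (StarAlgebra.subset_adjoin ℂ _ (by simp))

/-- The first generator. -/
noncomputable def genX : Alg R := ⟨ambX R, ambX_mem R⟩

/-- The second generator. -/
noncomputable def genY : Alg R := ⟨ambY R, ambY_mem R⟩

variable {R}

/-- Evaluation at a model. -/
noncomputable def eval (m : Model R) : Alg R →⋆ₐ[ℂ] m.carrier where
  toFun a := (a : sub R).1 m
  map_one' := rfl
  map_mul' _ _ := rfl
  map_zero' := rfl
  map_add' _ _ := rfl
  commutes' _ := rfl
  map_star' _ := rfl

theorem alg_ext {a b : Alg R} (h : ∀ m : Model R, eval m a = eval m b) : a = b :=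
  Subtype.ext (lp.ext (funext h))

@[simp] theorem eval_genX (m : Model R) : eval m (genX R) = m.x := rfl

@[simp] theorem eval_genY (m : Model R) : eval m (genY R) = m.y := rfl

/-- The universal property of `Alg R`. -/
theorem existsUnique_hom {B : Type u} [CStarAlgebra B] {x y : B} (h : R B x y)
    (hx : ‖x‖ ≤ 1) (hy : ‖y‖ ≤ 1) :
    ∃! φ : Alg R →⋆ₐ[ℂ] B, φ (genX R) = x ∧ φ (genY R) = y := by
  rcases subsingleton_or_nontrivial B with hB | hB
  · refine ⟨{ toFun := fun _ => 0, map_one' := Subsingleton.elim _ _,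
              map_mul' := fun _ _ => Subsingleton.elim _ _, map_zero' := rfl,
              map_add' := fun _ _ => Subsingleton.elim _ _,
              commutes' := fun _ => Subsingleton.elim _ _,
              map_star' := fun _ => Subsingleton.elim _ _ },
      ⟨Subsingleton.elim _ _, Subsingleton.elim _ _⟩, fun ψ _ => ?_⟩
    exact StarAlgHom.ext fun _ => Subsingleton.elim _ _
  · refine ⟨eval ⟨B, x, y, h, hx, hy⟩, ⟨rfl, rfl⟩, fun ψ hψ => ?_⟩
    set φ : Alg R →⋆ₐ[ℂ] B := eval ⟨B, x, y, h, hx, hy⟩ with hφ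
    have hφc : Continuous φ :=
      AddMonoidHomClass.continuous_of_bound φ 1 fun a => by
        simpa using NonUnitalStarAlgHom.norm_apply_le φ a
    have hψc : Continuous ψ :=
      AddMonoidHomClass.continuous_of_bound ψ 1 fun a => by
        simpa using NonUnitalStarAlgHom.norm_apply_le ψ a
    refine StarAlgHom.ext_topologicalClosure (φ := ψ) (ψ := φ) hψc hφc ?_
    refine StarAlgHom.ext_adjoin fun z hz => ?_
    obtain ⟨z, hz'⟩ := z
    rcases hz with rfl | rfl
    · exact hψ.1
    · exact hψ.2

theorem norm_le_one_of_isometry {A : Type u} [CStarAlgebra A] {x : A} (h : star x * x = 1) :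
    ‖x‖ ≤ 1 := by
  rcases subsingleton_or_nontrivial A with hA | hA
  · rw [Subsingleton.elim x 0, norm_zero]; exact zero_le_one
  · have h1 := CStarRing.norm_star_mul_self (x := x)
    rw [h, CStarRing.norm_one] at h1
    nlinarith [norm_nonneg x]

end UniversalCStar

/-! ## The 2-adic ring C*-algebra and the Cuntz algebra -/

/-- The defining relations of `Q₂` for a pair `(U, S)`: `U` is unitary, `S` is an isometry,
`S U = U² S` and `S S* + U S S* U* = 1`. -/
structure TwoAdicRelations (A : Type u) [CStarAlgebra A] (U S : A) : Prop where
  star_U_mul : star U * U = 1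
  U_mul_star : U * star U = 1
  isometry : star S * S = 1
  comm : S * U = U ^ 2 * S
  sum : S * star S + U * S * star S * star U = 1

/-- The defining relations of `O₂`: two isometries whose range projections add up to `1`. -/
structure CuntzRelations (A : Type u) [CStarAlgebra A] (X₁ X₂ : A) : Prop where
  isometry₁ : star X₁ * X₁ = 1
  isometry₂ : star X₂ * X₂ = 1
  sum : X₁ * star X₁ + X₂ * star X₂ = 1

/-- The isometry `S` is automatically proper. -/
theorem TwoAdicRelations.proper {A : Type u} [CStarAlgebra A] [Nontrivial A] {U S : A}
    (h : TwoAdicRelations A U S) : S * star S ≠ 1 := by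
  intro h1
  have h2 := h.sum
  rw [mul_assoc U S, h1, mul_one, h.U_mul_star] at h2
  exact one_ne_zero (add_eq_left.mp h2)

/-- The 2-adic ring C*-algebra `Q₂`. -/
abbrev TwoAdicRingAlgebra : Type (u + 1) := UniversalCStar.Alg.{u} TwoAdicRelations

/-- The Cuntz algebra `O₂`. -/
abbrev CuntzAlgebra : Type (u + 1) := UniversalCStar.Alg.{u} CuntzRelations

namespace TwoAdicRingAlgebra

/-- The unitary generator `U` of `Q₂`. -/
noncomputable def U : TwoAdicRingAlgebra.{u} := UniversalCStar.genX TwoAdicRelations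

/-- The isometric generator `S₂` of `Q₂`. -/
noncomputable def S₂ : TwoAdicRingAlgebra.{u} := UniversalCStar.genY TwoAdicRelations

theorem relations : TwoAdicRelations TwoAdicRingAlgebra.{u} U S₂ where
  star_U_mul := UniversalCStar.alg_ext fun m => by simpa [U, map_star] using m.rel.star_U_mul
  U_mul_star := UniversalCStar.alg_ext fun m => by simpa [U, map_star] using m.rel.U_mul_star
  isometry := UniversalCStar.alg_ext fun m => by simpa [S₂, map_star] using m.rel.isometry
  comm := UniversalCStar.alg_ext fun m => by simpa [U, S₂, map_star] using m.rel.comm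
  sum := UniversalCStar.alg_ext fun m => by simpa [U, S₂, map_star] using m.rel.sum

/-- The universal property of `Q₂`. -/
theorem existsUnique_hom {B : Type u} [CStarAlgebra B] {V T : B} (h : TwoAdicRelations B V T) :
    ∃! φ : TwoAdicRingAlgebra.{u} →⋆ₐ[ℂ] B, φ U = V ∧ φ S₂ = T :=
  UniversalCStar.existsUnique_hom h
    (UniversalCStar.norm_le_one_of_isometry h.star_U_mul)
    (UniversalCStar.norm_le_one_of_isometry h.isometry)

end TwoAdicRingAlgebra

namespace CuntzAlgebra

/-- The first generating isometry of `O₂`. -/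
noncomputable def X₁ : CuntzAlgebra.{u} := UniversalCStar.genX CuntzRelations

/-- The second generating isometry of `O₂`. -/
noncomputable def X₂ : CuntzAlgebra.{u} := UniversalCStar.genY CuntzRelations

theorem relations : CuntzRelations CuntzAlgebra.{u} X₁ X₂ where
  isometry₁ := UniversalCStar.alg_ext fun m => by simpa [X₁, map_star] using m.rel.isometry₁
  isometry₂ := UniversalCStar.alg_ext fun m => by simpa [X₂, map_star] using m.rel.isometry₂
  sum := UniversalCStar.alg_ext fun m => by simpa [X₁, X₂, map_star] using m.rel.sum

/-- The universal property of `O₂`. -/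
theorem existsUnique_hom {B : Type u} [CStarAlgebra B] {Y₁ Y₂ : B} (h : CuntzRelations B Y₁ Y₂) :
    ∃! φ : CuntzAlgebra.{u} →⋆ₐ[ℂ] B, φ X₁ = Y₁ ∧ φ X₂ = Y₂ :=
  UniversalCStar.existsUnique_hom h
    (UniversalCStar.norm_le_one_of_isometry h.isometry₁)
    (UniversalCStar.norm_le_one_of_isometry h.isometry₂)

theorem relations_in_twoAdic :
    CuntzRelations TwoAdicRingAlgebra.{u}
      (TwoAdicRingAlgebra.U * TwoAdicRingAlgebra.S₂) TwoAdicRingAlgebra.S₂ where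
  isometry₁ := by
    have h := TwoAdicRingAlgebra.relations.{u}
    rw [star_mul, mul_assoc, ← mul_assoc (star TwoAdicRingAlgebra.U), h.star_U_mul, one_mul,
      h.isometry]
  isometry₂ := TwoAdicRingAlgebra.relations.isometry
  sum := by
    have h := TwoAdicRingAlgebra.relations.{u}
    rw [star_mul, ← mul_assoc, add_comm]
    exact h.sum

/-- The inclusion `O₂ ⊂ Q₂`, sending `X₁` to `U S₂` and `X₂` to `S₂`. (The universe of the models
of `O₂` is raised by one so that `Q₂` itself is among them.) -/
noncomputable def toTwoAdic : CuntzAlgebra.{u + 1} →⋆ₐ[ℂ] TwoAdicRingAlgebra.{u} :=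
  (existsUnique_hom relations_in_twoAdic).choose

theorem toTwoAdic_X₁ :
    toTwoAdic.{u} X₁ = TwoAdicRingAlgebra.U * TwoAdicRingAlgebra.S₂ :=
  (existsUnique_hom relations_in_twoAdic).choose_spec.1.1

theorem toTwoAdic_X₂ : toTwoAdic.{u} X₂ = TwoAdicRingAlgebra.S₂ :=
  (existsUnique_hom relations_in_twoAdic).choose_spec.1.2

end CuntzAlgebra

/-! ## Representations on Hilbert spaces -/

namespace Rep

section

variable {A : Type u} [CStarAlgebra A]
  {H : Type v} [NormedAddCommGroup H] [InnerProductSpace ℂ H] [CompleteSpace H]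
  {K : Type w} [NormedAddCommGroup K] [InnerProductSpace ℂ K] [CompleteSpace K]

/-- The subspace `M` is invariant under the representation `ρ`. -/
def IsInvariant (ρ : A →⋆ₐ[ℂ] (H →L[ℂ] H)) (M : Submodule ℂ H) : Prop :=
  ∀ a : A, ∀ x ∈ M, ρ a x ∈ M

/-- The restriction of a representation to a closed invariant subspace. -/
noncomputable def subrep (ρ : A →⋆ₐ[ℂ] (H →L[ℂ] H)) (M : Submodule ℂ H) [CompleteSpace M]
    (hM : IsInvariant ρ M) : A →⋆ₐ[ℂ] (M →L[ℂ] M) where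
  toFun a := ((ρ a).comp M.subtypeL).codRestrict M fun x => hM a x x.2
  map_one' := by ext x; simp
  map_mul' a b := by
    ext x
    change ρ (a * b) x = ρ a (ρ b x)
    rw [map_mul]; rfl
  map_zero' := by ext x; simp
  map_add' a b := by
    ext x
    change ρ (a + b) x = ρ a x + ρ b x
    rw [map_add]; rfl
  commutes' r := by ext x; simp [Algebra.algebraMap_eq_smul_one]
  map_star' a := by
    rw [ContinuousLinearMap.star_eq_adjoint, ContinuousLinearMap.eq_adjoint_iff]
    intro x y
    change inner ℂ (ρ (star a) x) (y : H) = inner ℂ (x : H) (ρ a y)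
    rw [map_star, ContinuousLinearMap.star_eq_adjoint, ContinuousLinearMap.adjoint_inner_left]

/-- A representation is irreducible if the space is nonzero and the only closed invariant
subspaces are trivial. -/
def IsIrreducible (ρ : A →⋆ₐ[ℂ] (H →L[ℂ] H)) : Prop :=
  Nontrivial H ∧ ∀ M : Submodule ℂ H, IsClosed (M : Set H) → IsInvariant ρ M → M = ⊥ ∨ M = ⊤

/-- Unitary equivalence of representations. -/
def UnitarilyEquivalent (ρ : A →⋆ₐ[ℂ] (H →L[ℂ] H)) (ρ' : A →⋆ₐ[ℂ] (K →L[ℂ] K)) : Prop :=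
  ∃ V : H ≃ₗᵢ[ℂ] K, ∀ (a : A) (x : H), V (ρ a x) = ρ' a (V x)

/-- The closed linear span of the basis vectors with index in `I`. -/
noncomputable def basisSpan (b : HilbertBasis ℕ ℂ H) (I : Set ℕ) : Submodule ℂ H :=
  (Submodule.span ℂ (b '' I)).topologicalClosure

instance (b : HilbertBasis ℕ ℂ H) (I : Set ℕ) : CompleteSpace (basisSpan b I) :=
  inferInstanceAs (CompleteSpace (Submodule.span ℂ (b '' I)).topologicalClosure)

/-- `ρ` is the Hilbert space direct sum of irreducible subrepresentations, the `j`-th one acting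
on the closed span of the basis vectors with index in `I j`. -/
structure IsIrreducibleDecomposition (ρ : A →⋆ₐ[ℂ] (H →L[ℂ] H)) (b : HilbertBasis ℕ ℂ H)
    {J : Type} (I : J → Set ℕ) : Prop where
  invariant : ∀ j, IsInvariant ρ (basisSpan b (I j))
  irreducible : ∀ j, IsIrreducible (subrep ρ (basisSpan b (I j)) (invariant j))
  hilbertSum : IsHilbertSum ℂ (fun j => basisSpan b (I j))
    (fun j => (basisSpan b (I j)).subtypeₗᵢ)

/-- `ρ` decomposes into a direct sum of irreducible permutative subrepresentations. -/
def DecomposesIntoIrreducibles (ρ : A →⋆ₐ[ℂ] (H →L[ℂ] H)) (b : HilbertBasis ℕ ℂ H) : Prop :=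
  ∃ (J : Type) (I : J → Set ℕ), IsIrreducibleDecomposition ρ b I

/-- `ρ` decomposes into a direct sum of pairwise inequivalent irreducible permutative
subrepresentations. -/
def DecomposesIntoDistinctIrreducibles (ρ : A →⋆ₐ[ℂ] (H →L[ℂ] H)) (b : HilbertBasis ℕ ℂ H) :
    Prop :=
  ∃ (J : Type) (I : J → Set ℕ) (h : IsIrreducibleDecomposition ρ b I),
    ∀ j k : J, j ≠ k → ¬ UnitarilyEquivalent
      (subrep ρ (basisSpan b (I j)) (h.invariant j)) (subrep ρ (basisSpan b (I k)) (h.invariant k))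

end

end Rep

/-! ## Branching function systems and the coding map -/

/-- A branching function system of order 2. The letters `1, 2` are written `0, 1 : Fin 2`. -/
structure BranchingSystem where
  map : Fin 2 → ℕ → ℕ
  injective : ∀ i, Function.Injective (map i)
  disjoint : Disjoint (Set.range (map 0)) (Set.range (map 1))
  cover : Set.range (map 0) ∪ Set.range (map 1) = Set.univ

namespace BranchingSystem

variable (σ : BranchingSystem)

/-- `σ.word [i₁, …, iₖ] = σ_{i₁} ∘ ⋯ ∘ σ_{iₖ}`. -/
def word (l : List (Fin 2)) (n : ℕ) : ℕ := l.foldr σ.map n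

theorem map_eq_map {i j : Fin 2} {m n : ℕ} (h : σ.map i m = σ.map j n) : i = j ∧ m = n := by
  have hd := Set.disjoint_left.mp σ.disjoint
  have hij : i = j := by
    fin_cases i <;> fin_cases j
    · rfl
    · exact absurd ⟨n, h.symm⟩ (hd ⟨m, rfl⟩)
    · exact absurd ⟨m, h⟩ (hd ⟨n, rfl⟩)
    · rfl
  subst hij
  exact ⟨rfl, σ.injective i h⟩

theorem exists_map_eq (n : ℕ) : ∃ p : Fin 2 × ℕ, σ.map p.1 p.2 = n := by
  have h : n ∈ Set.range (σ.map 0) ∪ Set.range (σ.map 1) := by rw [σ.cover]; trivial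
  rcases h with ⟨m, hm⟩ | ⟨m, hm⟩
  · exact ⟨(0, m), hm⟩
  · exact ⟨(1, m), hm⟩

theorem word_eq_word {l l' : List (Fin 2)} (hl : l.length = l'.length) {m n : ℕ}
    (h : σ.word l m = σ.word l' n) : l = l' := by
  induction l generalizing l' with
  | nil => exact (List.length_eq_zero_iff.mp hl.symm).symm
  | cons i l ih =>
    cases l' with
    | nil => simp at hl
    | cons j l' =>
      obtain ⟨h1, h2⟩ := σ.map_eq_map (i := i) (j := j) h
      rw [h1, ih (by simpa using hl) h2]

/-- There is exactly one sequence `(i₁, i₂, …)` such that `n` lies in the range of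
`σ_{i₁} ∘ ⋯ ∘ σ_{iₖ}` for all `k`. -/
theorem existsUnique_code (n : ℕ) :
    ∃! s : ℕ → Fin 2, ∀ k : ℕ, n ∈ Set.range (σ.word (List.ofFn fun j : Fin k => s j)) := by
  choose step hstep using σ.exists_map_eq
  let s : ℕ → ℕ → Fin 2 := fun n k => (step ((fun m => (step m).2)^[k] n)).1
  have key : ∀ k n, σ.word (List.ofFn fun j : Fin k => s n j) ((fun m => (step m).2)^[k] n) = n := by
    intro k
    induction k with
    | zero => intro n; simp [word]
    | succ k ih =>
      intro n
      have h1 := ih (step n).2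
      rw [List.ofFn_succ]
      change σ.map (step n).1 (σ.word (List.ofFn fun j : Fin k => s (step n).2 j)
        ((fun m => (step m).2)^[k] (step n).2)) = n
      rw [h1, hstep]
  refine ⟨s n, fun k => ⟨_, key k n⟩, fun t ht => funext fun k => ?_⟩
  obtain ⟨m, hm⟩ := ht (k + 1)
  have h2 := σ.word_eq_word (by simp) (hm.trans (key (k + 1) n).symm)
  have h3 := congrFun (List.ofFn_injective h2) (Fin.last k)
  simpa using h3

/-- The coding map. -/
noncomputable def coding (n : ℕ) : ℕ → Fin 2 := (σ.existsUnique_code n).choose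

/-- If `n` and `σ_{i₁} ∘ ⋯ ∘ σ_{iₖ} (n)` have the same code, then they are equal. -/
def CodingPartiallyInjective : Prop :=
  ∀ (n : ℕ) (l : List (Fin 2)), σ.coding n = σ.coding (σ.word l n) → n = σ.word l n

end BranchingSystem

/-! ## Permutative representations -/

section

variable {H : Type v} [NormedAddCommGroup H] [InnerProductSpace ℂ H] [CompleteSpace H]

/-- A representation of `Q₂` is permutative with respect to the orthonormal basis `b`. -/
def TwoAdicRingAlgebra.IsPermutative (ρ : TwoAdicRingAlgebra.{u} →⋆ₐ[ℂ] (H →L[ℂ] H))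
    (b : HilbertBasis ℕ ℂ H) : Prop :=
  ∃ (σ₂ : ℕ → ℕ) (τ : Equiv.Perm ℕ), Function.Injective σ₂ ∧
    ∀ n, ρ TwoAdicRingAlgebra.S₂ (b n) = b (σ₂ n) ∧ ρ TwoAdicRingAlgebra.U (b n) = b (τ n)

namespace CuntzAlgebra

/-- The representation `π` of `O₂` is permutative with respect to the orthonormal basis `b`, with
branching function system `σ`. -/
def IsImplementedBy (π : CuntzAlgebra.{u} →⋆ₐ[ℂ] (H →L[ℂ] H)) (b : HilbertBasis ℕ ℂ H)
    (σ : BranchingSystem) : Prop :=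
  ∀ n, π X₁ (b n) = b (σ.map 0 n) ∧ π X₂ (b n) = b (σ.map 1 n)

/-- Regularity in the sense of Bratteli and Jorgensen. -/
def IsRegular (π : CuntzAlgebra.{u} →⋆ₐ[ℂ] (H →L[ℂ] H)) (b : HilbertBasis ℕ ℂ H) : Prop :=
  ∃ σ : BranchingSystem, IsImplementedBy π b σ ∧ σ.CodingPartiallyInjective

/-- Multiplicity-freeness in the sense of Bratteli and Jorgensen. -/
def IsMultiplicityFree (π : CuntzAlgebra.{u} →⋆ₐ[ℂ] (H →L[ℂ] H)) (b : HilbertBasis ℕ ℂ H) : Prop :=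
  ∃ σ : BranchingSystem, IsImplementedBy π b σ ∧ Function.Injective σ.coding

/-- The restriction to `O₂` of a representation of `Q₂`. -/
noncomputable def restrict (ρ : TwoAdicRingAlgebra.{u} →⋆ₐ[ℂ] (H →L[ℂ] H)) :
    CuntzAlgebra.{u + 1} →⋆ₐ[ℂ] (H →L[ℂ] H) :=
  ρ.comp toTwoAdic

end CuntzAlgebra

end

/-!
The code of a basis index is the 2-adic integer whose binary digits record how to walk backwards
from it; on codes `τ` acts as `x ↦ x + 1` and `σ₂` as `x ↦ 2 x`, and two indices have the same
coding sequence exactly when they have the same code. The range projections of the `U ^ r * S₂ ^ k`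
act on basis vectors as indicators of 2-adic balls of codes, so operators commuting with a
permutative representation cannot mix basis vectors with different codes. Conversely, two indices
of one orbit with the same code are exchanged by a bijection commuting with `σ₂` and `τ`, hence by
a unitary in the commutant, which Schur's lemma forbids in an irreducible representation. Thus the
irreducible permutative representations are the single orbits with injective code, two of them are
equivalent when they share a code, and the direct sum decompositions are read off the orbits.
-/

theorem eq_of_forall_pow_dvd_sub {R : Type*} [CommRing R] [IsDomain R] [WfDvdMonoid R] {p : R}
    (hp : ¬IsUnit p) {x y : R} (h : ∀ k, p ^ k ∣ x - y) : x = y := by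
  by_contra hxy
  obtain ⟨k, hk⟩ := FiniteMultiplicity.of_not_isUnit hp (sub_ne_zero.mpr hxy)
  exact hk (h (k + 1))

theorem not_isUnit_two_padicInt : ¬IsUnit (2 : ℤ_[2]) := by
  exact_mod_cast (PadicInt.prime_p (p := 2)).not_isUnit

theorem exists_int_of_two_pow_mul_padicInt_eq {k : ℕ} {x : ℤ_[2]} {a : ℤ}
    (h : 2 ^ k * x = a) : ∃ c : ℤ, a = 2 ^ k * c ∧ x = c := by
  obtain ⟨c, rfl⟩ : (2 : ℤ) ^ k ∣ a := by
    exact_mod_cast (PadicInt.pow_p_dvd_int_iff k a).mp ⟨x, by exact_mod_cast h.symm⟩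
  push_cast at h
  exact ⟨c, rfl, mul_left_cancel₀ (pow_ne_zero k two_ne_zero) h⟩

theorem two_mul_padicInt_ne_one_add_two_mul (x y : ℤ_[2]) : 2 * x ≠ 1 + 2 * y := fun h =>
  not_isUnit_two_padicInt (.of_mul_eq_one (x - y) (by linear_combination h))

/-- Two maps of a set which satisfy the relations of `Q₂`: the action of the generators on the
indices of a permutative representation. -/
structure TwoAdicSystem (ι : Type*) where
  σ : ι → ι
  τ : Equiv.Perm ι
  σ_injective : Function.Injective σ
  σ_τ : ∀ n, σ (τ n) = τ (τ (σ n))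
  σ_ne_τ_σ : ∀ m n, σ m ≠ τ (σ n)
  cover : ∀ n, ∃ m, n = σ m ∨ n = τ (σ m)

namespace TwoAdicSystem

variable {ι : Type*} (T : TwoAdicSystem ι)

theorem zpow_zpow (a b : ℤ) (n : ι) : (T.τ ^ a) ((T.τ ^ b) n) = (T.τ ^ (a + b)) n := by
  rw [zpow_add, Equiv.Perm.mul_apply]

theorem σ_zpow (a : ℤ) (n : ι) : T.σ ((T.τ ^ a) n) = (T.τ ^ (2 * a)) (T.σ n) := by
  have nat_case (k : ℕ) (n : ι) : T.σ ((T.τ ^ k) n) = (T.τ ^ (2 * k)) (T.σ n) := by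
    induction k generalizing n with
    | zero => rfl
    | succ k ih =>
      rw [pow_succ, Equiv.Perm.mul_apply, ih, σ_τ, mul_add, pow_add]
      rfl
  obtain ⟨k, rfl | rfl⟩ := a.eq_nat_or_neg
  · exact_mod_cast nat_case k n
  · have h := nat_case k ((T.τ ^ (-k : ℤ)) n)
    rw [← zpow_natCast, zpow_zpow, add_neg_cancel, zpow_zero, Equiv.Perm.one_apply,
      ← zpow_natCast] at h
    rw [h, zpow_zpow]
    simp

theorem iterate_zpow (k : ℕ) (a : ℤ) (n : ι) :
    T.σ^[k] ((T.τ ^ a) n) = (T.τ ^ (2 ^ k * a)) (T.σ^[k] n) := by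
  induction k generalizing a n with
  | zero => simp
  | succ k ih =>
    rw [Function.iterate_succ_apply, σ_zpow, ih, Function.iterate_succ_apply, pow_succ, mul_assoc]

/-! ### Codes -/

/-- The preimage of an index under whichever of `σ` and `τ ∘ σ` has it in its range. -/
noncomputable def tail (n : ι) : ι := (T.cover n).choose

theorem eq_σ_tail_or (n : ι) : n = T.σ (T.tail n) ∨ n = T.τ (T.σ (T.tail n)) :=
  (T.cover n).choose_spec

@[simp] theorem tail_σ (n : ι) : T.tail (T.σ n) = n :=
  (T.eq_σ_tail_or (T.σ n)).elim (fun h => T.σ_injective h.symm)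
    fun h => absurd h (T.σ_ne_τ_σ _ _)

@[simp] theorem tail_τ_σ (n : ι) : T.tail (T.τ (T.σ n)) = n :=
  (T.eq_σ_tail_or (T.τ (T.σ n))).elim (fun h => absurd h.symm (T.σ_ne_τ_σ _ _))
    fun h => T.σ_injective (T.τ.injective h.symm)

open Classical in
/-- The last binary digit of the code of an index. -/
noncomputable def digit (n : ι) : ℤ_[2] := if n = T.σ (T.tail n) then 0 else 1

/-- The code of an index: the 2-adic integer whose binary digits record which of `σ` and `τ ∘ σ`
are undone along the backward orbit of the index. It carries the information of the coding map of
Bratteli and Jorgensen, and turns `τ` into `x ↦ x + 1` and `σ` into `x ↦ 2 x`. -/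
noncomputable def code (n : ι) : ℤ_[2] := ∑' k, T.digit (T.tail^[k] n) * 2 ^ k

theorem code_eq_digit_add (n : ι) : T.code n = T.digit n + 2 * T.code (T.tail n) := by
  have summable (n : ι) : Summable fun k => T.digit (T.tail^[k] n) * 2 ^ k := by
    refine .of_norm_bounded summable_geometric_two fun k => ?_
    rw [norm_mul, norm_pow, ← Nat.cast_ofNat (R := ℤ_[2]), PadicInt.norm_p, one_div]
    exact mul_le_of_le_one_left (by positivity) (PadicInt.norm_le_one _)
  rw [code, (summable n).tsum_eq_zero_add, code, ← (summable _).tsum_mul_left]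
  simp only [Function.iterate_zero_apply, pow_zero, mul_one, Function.iterate_succ_apply, pow_succ]
  congr 2 with k
  ring

@[simp] theorem code_σ (n : ι) : T.code (T.σ n) = 2 * T.code n := by
  simp [T.code_eq_digit_add (T.σ n), digit]

theorem code_τ_σ (n : ι) : T.code (T.τ (T.σ n)) = 1 + 2 * T.code n := by
  simp [T.code_eq_digit_add (T.τ (T.σ n)), digit, (T.σ_ne_τ_σ _ _).symm]

theorem eq_code {c : ι → ℤ_[2]} (hσ : ∀ n, c (T.σ n) = 2 * c n)
    (hτσ : ∀ n, c (T.τ (T.σ n)) = 1 + 2 * c n) : c = T.code := by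
  funext n
  refine eq_of_forall_pow_dvd_sub not_isUnit_two_padicInt fun k => ?_
  induction k generalizing n with
  | zero => simp
  | succ k ih =>
    obtain ⟨m, rfl | rfl⟩ := T.cover n
    all_goals
      rw [pow_succ']
      convert mul_dvd_mul_left 2 (ih m) using 1
      simp only [hσ, hτσ, code_σ, code_τ_σ]
      ring

@[simp] theorem code_τ (n : ι) : T.code (T.τ n) = T.code n + 1 := by
  refine eq_of_forall_pow_dvd_sub not_isUnit_two_padicInt fun k => ?_
  induction k generalizing n with
  | zero => simp
  | succ k ih =>
    obtain ⟨m, rfl | rfl⟩ := T.cover n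
    · simp [code_τ_σ, add_comm]
    · rw [← σ_τ, code_σ, code_τ_σ, pow_succ']
      convert mul_dvd_mul_left 2 (ih m) using 1
      ring

@[simp] theorem code_zpow (a : ℤ) (n : ι) : T.code ((T.τ ^ a) n) = T.code n + a := by
  induction a using Int.induction_on with
  | zero => simp
  | succ i ih => rw [add_comm, zpow_one_add, Equiv.Perm.mul_apply, code_τ, ih]; push_cast; ring
  | pred i ih =>
    rw [← add_left_inj 1, ← code_τ, ← Equiv.Perm.mul_apply, ← zpow_one_add, add_sub_cancel, ih]
    push_cast
    ring

@[simp] theorem code_iterate (k : ℕ) (n : ι) : T.code (T.σ^[k] n) = 2 ^ k * T.code n := by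
  induction k with
  | zero => simp
  | succ k ih => rw [Function.iterate_succ_apply', code_σ, ih, pow_succ', mul_assoc]

theorem exists_eq_σ_of_two_dvd_code {n : ι} (h : 2 ∣ T.code n) : ∃ m, n = T.σ m := by
  obtain ⟨m, hm | rfl⟩ := T.cover n
  · exact ⟨m, hm⟩
  · obtain ⟨x, hx⟩ := h
    rw [code_τ_σ] at hx
    exact absurd hx.symm (two_mul_padicInt_ne_one_add_two_mul _ _)

theorem exists_eq_iterate_of_two_pow_dvd_code {k : ℕ} {n : ι} (h : 2 ^ k ∣ T.code n) :
    ∃ m, n = T.σ^[k] m := by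
  induction k generalizing n with
  | zero => exact ⟨n, rfl⟩
  | succ k ih =>
    obtain ⟨m, rfl⟩ := T.exists_eq_σ_of_two_dvd_code ((dvd_pow_self 2 k.succ_ne_zero).trans h)
    rw [code_σ, pow_succ', mul_dvd_mul_iff_left two_ne_zero] at h
    obtain ⟨l, rfl⟩ := ih h
    exact ⟨l, (Function.iterate_succ_apply' ..).symm⟩

theorem mem_range_zpow_iterate_iff {k : ℕ} {r : ℤ} {n : ι} :
    (∃ m, n = (T.τ ^ r) (T.σ^[k] m)) ↔ 2 ^ k ∣ T.code n - r := by
  refine ⟨?_, fun h => ?_⟩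
  · rintro ⟨m, rfl⟩
    simp
  · obtain ⟨m, hm⟩ := T.exists_eq_iterate_of_two_pow_dvd_code (n := (T.τ ^ (-r)) n) (k := k)
      (by rwa [code_zpow, Int.cast_neg, ← sub_eq_add_neg])
    exact ⟨m, by rw [← hm, zpow_zpow]; simp⟩

/-! ### Orbits -/

/-- A set of indices stable under `σ`, `τ` and their inverses. -/
structure Invariant (I : Set ι) : Prop where
  τ_mem : ∀ n, T.τ n ∈ I ↔ n ∈ I
  σ_mem : ∀ n, T.σ n ∈ I ↔ n ∈ I

/-- Two indices are connected if they lie in the same orbit of the system. -/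
def Connected (m n : ι) : Prop := ∃ (p q : ℕ) (a : ℤ), T.σ^[p] n = (T.τ ^ a) (T.σ^[q] m)

variable {T}

theorem Invariant.zpow_mem {I : Set ι} (hI : T.Invariant I) (a : ℤ) (n : ι) :
    (T.τ ^ a) n ∈ I ↔ n ∈ I := by
  induction a using Int.induction_on with
  | zero => rfl
  | succ i ih => rw [add_comm, zpow_one_add, Equiv.Perm.mul_apply, hI.τ_mem, ih]
  | pred i ih => rw [← hI.τ_mem, ← Equiv.Perm.mul_apply, ← zpow_one_add, add_sub_cancel, ih]

theorem Invariant.iterate_mem {I : Set ι} (hI : T.Invariant I) (k : ℕ) (n : ι) :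
    T.σ^[k] n ∈ I ↔ n ∈ I := by
  induction k with
  | zero => rfl
  | succ k ih => rw [Function.iterate_succ_apply', hI.σ_mem, ih]

theorem Invariant.mem_iff_of_connected {I : Set ι} (hI : T.Invariant I) {m n : ι}
    (h : T.Connected m n) : m ∈ I ↔ n ∈ I := by
  obtain ⟨p, q, a, h⟩ := h
  rw [← hI.iterate_mem p n, h, hI.zpow_mem, hI.iterate_mem]

@[refl] theorem Connected.refl (n : ι) : T.Connected n n := ⟨0, 0, 0, rfl⟩

theorem Connected.symm {m n : ι} (h : T.Connected m n) : T.Connected n m := by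
  obtain ⟨p, q, a, h⟩ := h
  exact ⟨q, p, -a, by rw [h, zpow_zpow]; simp⟩

theorem Connected.trans {l m n : ι} (h : T.Connected l m) (h' : T.Connected m n) :
    T.Connected l n := by
  obtain ⟨p, q, a, h⟩ := h
  obtain ⟨p', q', a', h'⟩ := h'
  refine ⟨p + p', q' + q, 2 ^ p * a' + 2 ^ q' * a, ?_⟩
  rw [Function.iterate_add_apply, h', iterate_zpow, ← Function.iterate_add_apply, add_comm p,
    Function.iterate_add_apply, h, iterate_zpow, zpow_zpow, ← Function.iterate_add_apply]

theorem connected_τ (n : ι) : T.Connected n (T.τ n) := ⟨0, 0, 1, rfl⟩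

theorem connected_σ (n : ι) : T.Connected n (T.σ n) := ⟨0, 1, 0, rfl⟩

theorem Connected.exists_eq {m n : ι} (h : T.Connected m n) :
    ∃ (q : ℕ) (a : ℤ), n = (T.τ ^ a) (T.σ^[q] m) ∨ m = (T.τ ^ a) (T.σ^[q] n) := by
  have cancel {m n : ι} {p d : ℕ} {a : ℤ} (h : T.σ^[p] n = (T.τ ^ a) (T.σ^[p + d] m)) :
      ∃ c : ℤ, n = (T.τ ^ c) (T.σ^[d] m) := by
    rw [Function.iterate_add_apply] at h
    have hcode := congrArg T.code h
    rw [code_zpow, code_iterate, ← Function.iterate_add_apply, code_iterate, pow_add] at hcode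
    obtain ⟨c, rfl, -⟩ := exists_int_of_two_pow_mul_padicInt_eq (a := a) (k := p)
      (x := T.code n - 2 ^ d * T.code m) (by linear_combination hcode)
    exact ⟨c, T.σ_injective.iterate p (by rw [h, iterate_zpow])⟩
  obtain ⟨p, q, a, h⟩ := h
  rcases le_total p q with hpq | hqp
  · obtain ⟨d, rfl⟩ := Nat.exists_eq_add_of_le hpq
    obtain ⟨c, hc⟩ := cancel h
    exact ⟨d, c, .inl hc⟩
  · obtain ⟨d, rfl⟩ := Nat.exists_eq_add_of_le hqp
    obtain ⟨c, hc⟩ := cancel (a := -a) (m := n) (n := m) (by rw [h, zpow_zpow]; simp)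
    exact ⟨d, c, .inr hc⟩

variable (T) in
/-- The partition of the indices into orbits. -/
def orbitSetoid : Setoid ι where
  r := T.Connected
  iseqv := ⟨.refl, .symm, .trans⟩

theorem Connected.exists_int_mul_code_eq {m n : ι} {z a : ℤ} (h : T.Connected m n)
    (ha : z * T.code m = a) : ∃ c : ℤ, z * T.code n = c := by
  obtain ⟨p, q, b, h⟩ := h
  have hcode := congrArg T.code h
  rw [code_zpow, code_iterate, code_iterate] at hcode
  obtain ⟨c, -, hc⟩ := exists_int_of_two_pow_mul_padicInt_eq (k := p)
    (x := z * T.code n) (a := z * b + 2 ^ q * a)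
    (by push_cast; linear_combination z * hcode + 2 ^ q * ha)
  exact ⟨c, hc⟩

theorem invariant_setOf_connected (m : ι) : T.Invariant {n | T.Connected m n} where
  τ_mem n := ⟨fun h => h.trans (connected_τ n).symm, fun h => h.trans (connected_τ n)⟩
  σ_mem n := ⟨fun h => h.trans (connected_σ n).symm, fun h => h.trans (connected_σ n)⟩

variable (T) in
/-- The system induced on an invariant set of indices. -/
@[simps] def restrict {I : Set ι} (hI : T.Invariant I) : TwoAdicSystem I where
  σ n := ⟨T.σ n, (hI.σ_mem n).mpr n.2⟩
  τ := T.τ.subtypePerm hI.τ_mem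
  σ_injective m n h := Subtype.ext (T.σ_injective (congrArg Subtype.val h))
  σ_τ n := Subtype.ext (T.σ_τ n)
  σ_ne_τ_σ m n h := T.σ_ne_τ_σ m n (congrArg Subtype.val h)
  cover := by
    rintro ⟨n, hn⟩
    obtain ⟨m, rfl | rfl⟩ := T.cover n
    · exact ⟨⟨m, (hI.σ_mem m).mp hn⟩, .inl rfl⟩
    · exact ⟨⟨m, (hI.σ_mem m).mp ((hI.τ_mem _).mp hn)⟩, .inr rfl⟩

theorem code_restrict {I : Set ι} (hI : T.Invariant I) (n : I) :
    (T.restrict hI).code n = T.code n :=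
  (congrFun ((T.restrict hI).eq_code (c := fun n => T.code n) (fun n => T.code_σ n)
    fun n => T.code_τ_σ n) n).symm

theorem connected_restrict_iff {I : Set ι} (hI : T.Invariant I) {m n : I} :
    (T.restrict hI).Connected m n ↔ T.Connected m n := by
  have val_zpow (a : ℤ) (l : I) : (((T.restrict hI).τ ^ a) l : ι) = (T.τ ^ a) l := by
    simp [Equiv.Perm.subtypePerm_zpow]
  have val_iterate (k : ℕ) (l : I) : ((T.restrict hI).σ^[k] l : ι) = T.σ^[k] l :=
    Function.Semiconj.iterate_right (f := ((↑) : I → ι)) (fun _ => rfl) k l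
  simp only [Connected, Subtype.ext_iff, val_zpow, val_iterate]

end TwoAdicSystem

namespace TwoAdicSystem

variable {ι κ : Type*} {T : TwoAdicSystem ι} {T' : TwoAdicSystem κ}

/-! ### Equivariant bijections -/

section Shift

variable {q : ℕ} {shift : ι → ℤ}

theorem bijective_zpow_iterate (hshift : ∀ l, (1 - 2 ^ q) * T.code l = shift l) :
    Function.Bijective fun l => (T.τ ^ shift l) (T.σ^[q] l) := by
  have shift_eq {l l' : ι} (h : T.code l = T.code l') : shift l = shift l' := by
    exact_mod_cast (hshift l).symm.trans (h ▸ hshift l')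
  have code_shift (l : ι) : T.code ((T.τ ^ shift l) (T.σ^[q] l)) = T.code l := by
    rw [code_zpow, code_iterate]
    linear_combination -hshift l
  refine ⟨fun l l' h => ?_, fun l => ?_⟩
  · have hcode : T.code l = T.code l' := by
      rw [← code_shift l, ← code_shift l']
      exact congrArg T.code h
    simp only [shift_eq hcode] at h
    exact T.σ_injective.iterate q ((T.τ ^ shift l').injective h)
  · obtain ⟨l', hl'⟩ := (T.mem_range_zpow_iterate_iff (k := q) (r := shift l) (n := l)).mpr
      ⟨T.code l, by linear_combination hshift l⟩
    have hcode : T.code l' = T.code l := by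
      have h := congrArg T.code hl'
      rw [code_zpow, code_iterate] at h
      exact mul_left_cancel₀ (pow_ne_zero q two_ne_zero) (by linear_combination hshift l - h)
    exact ⟨l', by simp only [shift_eq hcode, ← hl']⟩

theorem semiconj_σ_zpow_iterate (hshift : ∀ l, (1 - 2 ^ q) * T.code l = shift l) :
    Function.Semiconj (fun l => (T.τ ^ shift l) (T.σ^[q] l)) T.σ T.σ := by
  intro l
  have h : (shift (T.σ l) : ℤ_[2]) = (2 * shift l : ℤ) := by
    rw [← hshift, code_σ]
    push_cast
    linear_combination 2 * hshift l
  simp only [Int.cast_injective h, ← Function.iterate_succ_apply, σ_zpow,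
    Function.iterate_succ_apply']

theorem semiconj_τ_zpow_iterate (hshift : ∀ l, (1 - 2 ^ q) * T.code l = shift l) :
    Function.Semiconj (fun l => (T.τ ^ shift l) (T.σ^[q] l)) T.τ T.τ := by
  intro l
  have h : (shift (T.τ l) : ℤ_[2]) = (1 + shift l - 2 ^ q : ℤ) := by
    rw [← hshift, code_τ]
    push_cast
    linear_combination hshift l
  have hτ : T.σ^[q] (T.τ l) = (T.τ ^ (2 ^ q : ℤ)) (T.σ^[q] l) := by
    simpa using T.iterate_zpow q 1 l
  simp only [Int.cast_injective h, hτ, zpow_zpow, sub_add_cancel]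
  rw [zpow_one_add, Equiv.Perm.mul_apply]

end Shift

/-- Equal codes make `(1 - 2 ^ q) * code m` the integer `a`, so `(1 - 2 ^ q) * code l` is an integer
for every `l`; moving `σ^[q] l` by this power of `τ` restores the code of `l`. -/
theorem exists_equivariant_perm_of_eq_zpow_iterate (hT : ∀ m n, T.Connected m n) {m n : ι} {q : ℕ}
    {a : ℤ} (hn : n = (T.τ ^ a) (T.σ^[q] m)) (hmn : T.code m = T.code n) :
    ∃ θ : Equiv.Perm ι, Function.Semiconj θ T.σ T.σ ∧ Function.Semiconj θ T.τ T.τ ∧ θ m = n := by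
  have ha : ((1 - 2 ^ q : ℤ) : ℤ_[2]) * T.code m = a := by
    rw [hn, code_zpow, code_iterate] at hmn
    push_cast
    linear_combination hmn
  choose shift hshift using fun l => (hT m l).exists_int_mul_code_eq ha
  have hshift_m : shift m = a := Int.cast_injective ((hshift m).symm.trans ha)
  push_cast at hshift
  exact ⟨.ofBijective _ (bijective_zpow_iterate hshift), semiconj_σ_zpow_iterate hshift,
    semiconj_τ_zpow_iterate hshift, by rw [Equiv.ofBijective_apply, hshift_m, hn]⟩

theorem exists_equivariant_perm (hT : ∀ m n, T.Connected m n) {m n : ι}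
    (hmn : T.code m = T.code n) :
    ∃ θ : Equiv.Perm ι, Function.Semiconj θ T.σ T.σ ∧ Function.Semiconj θ T.τ T.τ ∧ θ m = n := by
  obtain ⟨q, a, hn | hm⟩ := (hT m n).exists_eq
  · exact exists_equivariant_perm_of_eq_zpow_iterate hT hn hmn
  · obtain ⟨θ, hσ, hτ, h⟩ := exists_equivariant_perm_of_eq_zpow_iterate hT hm hmn.symm
    exact ⟨θ.symm, hσ.inverse_left θ.left_inv θ.right_inv, hτ.inverse_left θ.left_inv θ.right_inv,
      by rw [← h, θ.symm_apply_apply]⟩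

theorem range_code_subset (hT : ∀ m n, T.Connected m n) {m : ι} {n : κ}
    (hmn : T.code m = T'.code n) : Set.range T.code ⊆ Set.range T'.code := by
  rintro _ ⟨l, rfl⟩
  obtain ⟨p, q, a, h⟩ := hT m l
  have hcode : 2 ^ p * T.code l = T'.code ((T'.τ ^ a) (T'.σ^[q] n)) := by
    rw [code_zpow, code_iterate, ← hmn, ← code_iterate, ← code_iterate, ← code_zpow, h]
  obtain ⟨l', hl'⟩ := T'.exists_eq_iterate_of_two_pow_dvd_code ⟨_, hcode.symm⟩
  rw [hl', code_iterate] at hcode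
  exact ⟨l', (mul_left_cancel₀ (pow_ne_zero p two_ne_zero) hcode).symm⟩

theorem exists_equivariant_equiv (hT : ∀ m n, T.Connected m n) (hT' : ∀ m n, T'.Connected m n)
    (hinj : Function.Injective T.code) (hinj' : Function.Injective T'.code) {m : ι} {n : κ}
    (hmn : T.code m = T'.code n) :
    ∃ e : ι ≃ κ, Function.Semiconj e T.σ T'.σ ∧ Function.Semiconj e T.τ T'.τ := by
  have hrange : Set.range T.code = Set.range T'.code :=
    (range_code_subset hT hmn).antisymm (range_code_subset hT' hmn.symm)
  let e : ι ≃ κ := (Equiv.ofInjective _ hinj).trans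
    ((Equiv.setCongr hrange).trans (Equiv.ofInjective _ hinj').symm)
  have code_e (l : ι) : T'.code (e l) = T.code l :=
    Equiv.apply_ofInjective_symm hinj' ⟨T.code l, hrange ▸ Set.mem_range_self l⟩
  exact ⟨e, fun l => hinj' (by rw [code_e, code_σ, code_σ, code_e]),
    fun l => hinj' (by rw [code_e, code_τ, code_τ, code_e])⟩

end TwoAdicSystem

/-! ### The coding map -/

namespace BranchingSystem

theorem mem_range_word_coding (σ : BranchingSystem) (n k : ℕ) :
    n ∈ Set.range (σ.word (List.ofFn fun j : Fin k => σ.coding n j)) :=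
  (σ.existsUnique_code n).choose_spec.1 k

theorem coding_map (σ : BranchingSystem) (i : Fin 2) (n : ℕ) :
    σ.coding (σ.map i n) = fun k => k.casesOn i (σ.coding n) := by
  refine ((σ.existsUnique_code (σ.map i n)).choose_spec.2 _ fun k => ?_).symm
  cases k with
  | zero => exact ⟨_, rfl⟩
  | succ k =>
    obtain ⟨m, hm⟩ := σ.mem_range_word_coding n k
    exact ⟨m, by simpa [word, List.ofFn_succ] using congrArg (σ.map i) hm⟩

theorem coding_map_eq_coding_map (σ : BranchingSystem) {i j : Fin 2} {m n : ℕ}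
    (h : σ.coding (σ.map i m) = σ.coding (σ.map j n)) : i = j ∧ σ.coding m = σ.coding n := by
  rw [coding_map, coding_map] at h
  exact ⟨congrFun h 0, funext fun k => congrFun h (k + 1)⟩

end BranchingSystem

namespace TwoAdicSystem

variable {T : TwoAdicSystem ℕ}

variable (T) in
/-- The branching function system `σ₁ = τ ∘ σ`, `σ₂ = σ`. -/
def branching : BranchingSystem where
  map := ![T.τ ∘ T.σ, T.σ]
  injective := by
    rw [Fin.forall_fin_two]
    exact ⟨T.τ.injective.comp T.σ_injective, T.σ_injective⟩
  disjoint := by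
    rw [Set.disjoint_left]
    rintro _ ⟨m, rfl⟩ ⟨n, h⟩
    exact T.σ_ne_τ_σ n m h
  cover := by
    refine Set.eq_univ_of_forall fun n => ?_
    obtain ⟨m, rfl | rfl⟩ := T.cover n
    · exact .inr ⟨m, rfl⟩
    · exact .inl ⟨m, rfl⟩

theorem exists_word_eq_zpow_iterate {k : ℕ} {r : ℤ} (h0 : 0 ≤ r) (hr : r < 2 ^ k) :
    ∃ l, ∀ n, T.branching.word l n = (T.τ ^ r) (T.σ^[k] n) := by
  induction k generalizing r with
  | zero =>
    obtain rfl : r = 0 := by omega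
    exact ⟨[], fun n => rfl⟩
  | succ k ih =>
    obtain ⟨e, rfl | rfl⟩ := r.even_or_odd'
    · obtain ⟨l, hl⟩ := ih (r := e) (by omega) (by omega)
      refine ⟨1 :: l, fun n => ?_⟩
      rw [Function.iterate_succ_apply', ← σ_zpow, ← hl]
      rfl
    · obtain ⟨l, hl⟩ := ih (r := e) (by omega) (by omega)
      refine ⟨0 :: l, fun n => ?_⟩
      rw [Function.iterate_succ_apply', add_comm, ← zpow_zpow, ← σ_zpow, ← hl]
      rfl

theorem connected_word (l : List (Fin 2)) (n : ℕ) : T.Connected n (T.branching.word l n) := by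
  induction l with
  | nil => exact .refl n
  | cons i l ih =>
    fin_cases i
    · exact (ih.trans (connected_σ _)).trans (connected_τ _)
    · exact ih.trans (connected_σ _)

theorem code_map (i : Fin 2) (n : ℕ) :
    T.code (T.branching.map i n) = ![1, 0] i + 2 * T.code n := by
  fin_cases i
  · exact T.code_τ_σ n
  · exact (T.code_σ n).trans (zero_add _).symm

theorem code_map_eq_code_map {i j : Fin 2} {m n : ℕ}
    (h : T.code (T.branching.map i m) = T.code (T.branching.map j n)) :
    i = j ∧ T.code m = T.code n := by
  obtain rfl : i = j := by
    rw [code_map, code_map] at h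
    fin_cases i <;> fin_cases j
    · rfl
    · exact absurd (h.trans (zero_add _)).symm (two_mul_padicInt_ne_one_add_two_mul _ _)
    · exact absurd (h.symm.trans (zero_add _)).symm (two_mul_padicInt_ne_one_add_two_mul _ _)
    · rfl
  rw [code_map, code_map, add_right_inj, mul_right_inj' two_ne_zero] at h
  exact ⟨rfl, h⟩

theorem coding_eq_coding_iff {m n : ℕ} :
    T.branching.coding m = T.branching.coding n ↔ T.code m = T.code n := by
  constructor <;> intro h
  · refine eq_of_forall_pow_dvd_sub not_isUnit_two_padicInt fun k => ?_
    induction k generalizing m n with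
    | zero => simp
    | succ k ih =>
      obtain ⟨⟨i, m⟩, rfl⟩ := T.branching.exists_map_eq m
      obtain ⟨⟨j, n⟩, rfl⟩ := T.branching.exists_map_eq n
      obtain ⟨rfl, h⟩ := T.branching.coding_map_eq_coding_map h
      rw [code_map, code_map, add_sub_add_left_eq_sub, ← mul_sub, pow_succ']
      exact mul_dvd_mul_left 2 (ih h)
  · funext k
    induction k generalizing m n with
    | zero =>
      obtain ⟨⟨i, m⟩, rfl⟩ := T.branching.exists_map_eq m
      obtain ⟨⟨j, n⟩, rfl⟩ := T.branching.exists_map_eq n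
      obtain ⟨rfl, -⟩ := code_map_eq_code_map h
      rw [BranchingSystem.coding_map, BranchingSystem.coding_map]
      rfl
    | succ k ih =>
      obtain ⟨⟨i, m⟩, rfl⟩ := T.branching.exists_map_eq m
      obtain ⟨⟨j, n⟩, rfl⟩ := T.branching.exists_map_eq n
      rw [BranchingSystem.coding_map, BranchingSystem.coding_map]
      exact ih (code_map_eq_code_map h).2

theorem codingPartiallyInjective_iff : T.branching.CodingPartiallyInjective ↔
    ∀ m n, T.Connected m n → T.code m = T.code n → m = n := by
  refine ⟨fun hreg => ?_, fun h n l hl => h _ _ (connected_word l n) (coding_eq_coding_iff.mp hl)⟩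
  -- If `a = r + j * (2 ^ q - 1)` with `0 ≤ r`, then `τ ^ j` conjugates `τ ^ a ∘ σ^[q]` into the
  -- word `τ ^ r ∘ σ^[q]`.
  have eq_of_eq_zpow_iterate {m n q : ℕ} {a : ℤ} (hn : n = (T.τ ^ a) (T.σ^[q] m))
      (hmn : T.code m = T.code n) : m = n := by
    rcases q.eq_zero_or_pos with rfl | hq
    · obtain rfl : a = 0 := by simpa [hn] using hmn
      exact hn.symm
    · have hq' : (1 : ℤ) < 2 ^ q := one_lt_pow₀ (by norm_num) hq.ne'
      obtain ⟨l, hl⟩ := exists_word_eq_zpow_iterate (T := T) (k := q)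
        (Int.emod_nonneg a (by lia : (2 : ℤ) ^ q - 1 ≠ 0))
        ((Int.emod_lt_of_pos a (by lia)).trans (by lia))
      set j := a / (2 ^ q - 1)
      have hword : T.branching.word l ((T.τ ^ j) m) = (T.τ ^ j) n := by
        rw [hl, iterate_zpow, hn, zpow_zpow, zpow_zpow]
        congr 2
        linear_combination Int.emod_add_mul_ediv a (2 ^ q - 1)
      have h := hreg ((T.τ ^ j) m) l
        (by rw [hword, coding_eq_coding_iff, code_zpow, code_zpow, hmn])
      exact (T.τ ^ j).injective (h.trans hword)
  intro m n hc hmn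
  obtain ⟨q, a, hn | hm⟩ := hc.exists_eq
  · exact eq_of_eq_zpow_iterate hn hmn
  · exact (eq_of_eq_zpow_iterate hm hmn.symm).symm

end TwoAdicSystem

/-! ### Hilbert bases -/

section HilbertBasis

variable {𝕜 : Type*} [RCLike 𝕜] {ι κ : Type*}
  {H : Type*} [NormedAddCommGroup H] [InnerProductSpace 𝕜 H]
  {K : Type*} [NormedAddCommGroup K] [InnerProductSpace 𝕜 K]
  (b : HilbertBasis ι 𝕜 H) (b' : HilbertBasis κ 𝕜 K)

theorem hilbertBasis_injective : Function.Injective b :=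
  b.orthonormal.linearIndependent.injective

theorem continuousLinearMap_ext_hilbertBasis {f g : H →L[𝕜] K} (h : ∀ n, f (b n) = g (b n)) :
    f = g :=
  ContinuousLinearMap.ext_on ((Submodule.dense_iff_topologicalClosure_eq_top).mpr b.dense_span)
    (Set.forall_mem_range.mpr h)

/-- The unitary carrying one Hilbert basis to another along a bijection of the index types. -/
noncomputable def hilbertBasisEquiv [CompleteSpace K] (e : ι ≃ κ) : H ≃ₗᵢ[𝕜] K :=
  b.repr.trans (HilbertBasis.mk (b'.orthonormal.comp e e.injective)
    (by rw [EquivLike.range_comp, b'.dense_span])).repr.symm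

@[simp] theorem hilbertBasisEquiv_apply [CompleteSpace K] (e : ι ≃ κ) (n : ι) :
    hilbertBasisEquiv b b' e (b n) = b' (e n) := by
  classical
  rw [hilbertBasisEquiv, LinearIsometryEquiv.trans_apply, b.repr_self,
    HilbertBasis.repr_symm_single, HilbertBasis.coe_mk, Function.comp_apply]

variable {b}

theorem eq_zero_of_forall_inner_hilbertBasis_eq_zero {x : H} (h : ∀ n, inner 𝕜 (b n) x = 0) :
    x = 0 :=
  (b.hasSum_repr x).unique (by simp [b.repr_apply_apply, h])

theorem ext_inner_hilbertBasis {x y : H} (h : ∀ n, inner 𝕜 (b n) x = inner 𝕜 (b n) y) : x = y :=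
  sub_eq_zero.mp <| eq_zero_of_forall_inner_hilbertBasis_eq_zero (b := b) fun n => by
    rw [inner_sub_right, h, sub_self]

theorem eq_smul_of_forall_ne_inner_hilbertBasis_eq_zero {x : H} {n : ι}
    (h : ∀ m ≠ n, inner 𝕜 (b m) x = 0) : x = inner 𝕜 (b n) x • b n := by
  refine (b.hasSum_repr x).unique ?_
  rw [← b.repr_apply_apply]
  exact hasSum_single n fun m hm => by rw [b.repr_apply_apply, h m hm, zero_smul]

theorem closure_span_hilbertBasis_le {I : Set ι} {M : Submodule 𝕜 H} (hM : IsClosed (M : Set H))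
    (h : ∀ n ∈ I, b n ∈ M) : (Submodule.span 𝕜 (b '' I)).topologicalClosure ≤ M :=
  Submodule.topologicalClosure_minimal _ (Submodule.span_le.mpr (Set.forall_mem_image.mpr h)) hM

theorem inner_hilbertBasis_eq_zero_of_mem_closure_span {I : Set ι} {n : ι} (hn : n ∉ I) {x : H}
    (hx : x ∈ (Submodule.span 𝕜 (b '' I)).topologicalClosure) : inner 𝕜 (b n) x = 0 := by
  have h := closure_span_hilbertBasis_le (Submodule.isClosed_orthogonal (𝕜 ∙ b n)) (b := b)
    fun m hm => Submodule.mem_orthogonal_singleton_iff_inner_right.mpr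
      (b.orthonormal.2 fun h => hn (h ▸ hm))
  exact Submodule.mem_orthogonal_singleton_iff_inner_right.mp (h hx)

theorem hilbertBasis_mem_closure_span_iff {I : Set ι} {n : ι} :
    b n ∈ (Submodule.span 𝕜 (b '' I)).topologicalClosure ↔ n ∈ I := by
  refine ⟨fun h => ?_, fun h =>
    Submodule.le_topologicalClosure _ (Submodule.subset_span ⟨n, h, rfl⟩)⟩
  by_contra hn
  exact b.orthonormal.ne_zero n
    (inner_self_eq_zero.mp (inner_hilbertBasis_eq_zero_of_mem_closure_span hn h))

variable [CompleteSpace H] {V : H →L[𝕜] H} {f : ι → ι}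

theorem star_hilbertBasis_of_injective (hV : ∀ n, V (b n) = b (f n)) (hf : Function.Injective f)
    (n : ι) : star V (b (f n)) = b n := by
  classical
  refine ext_inner_hilbertBasis (b := b) fun m => ?_
  rw [ContinuousLinearMap.star_eq_adjoint, ContinuousLinearMap.adjoint_inner_right, hV,
    orthonormal_iff_ite.mp b.orthonormal, orthonormal_iff_ite.mp b.orthonormal]
  simp only [hf.eq_iff]

theorem star_hilbertBasis_of_notMem_range (hV : ∀ n, V (b n) = b (f n)) {n : ι}
    (hn : n ∉ Set.range f) : star V (b n) = 0 := by
  refine eq_zero_of_forall_inner_hilbertBasis_eq_zero (b := b) fun m => ?_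
  rw [ContinuousLinearMap.star_eq_adjoint, ContinuousLinearMap.adjoint_inner_right, hV]
  exact b.orthonormal.2 fun h => hn ⟨m, h⟩

end HilbertBasis

section Schur

open Rep

variable {A : Type u} [CStarAlgebra A]
  {H : Type v} [NormedAddCommGroup H] [InnerProductSpace ℂ H] [CompleteSpace H]
  {π : A →⋆ₐ[ℂ] (H →L[ℂ] H)}

theorem isInvariant_orthogonal {M : Submodule ℂ H} (hM : IsInvariant π M) : IsInvariant π Mᗮ := by
  intro a x hx y hy
  have h := hx _ (hM (star a) y hy)
  rwa [map_star, ContinuousLinearMap.star_eq_adjoint,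
    ContinuousLinearMap.adjoint_inner_left] at h

theorem starProjection_apply_of_isInvariant {M : Submodule ℂ H} [CompleteSpace M]
    (hM : IsInvariant π M) (a : A) (x : H) :
    M.starProjection (π a x) = π a (M.starProjection x) := by
  refine Submodule.eq_starProjection_of_mem_orthogonal'
    (hM a _ (Submodule.starProjection_apply_mem ..))
    (isInvariant_orthogonal hM a _ (Submodule.sub_starProjection_mem_orthogonal x)) ?_
  rw [← map_add, add_sub_cancel]

theorem eq_zero_or_eq_zero_of_mul_eq_zero_of_isIrreducible (hπ : IsIrreducible π) {F G : H →L[ℂ] H}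
    (hF : ∀ a, Commute F (π a)) (hFG : F * G = 0) : F = 0 ∨ G = 0 := by
  have hker : IsInvariant π F.ker := by
    intro a x hx
    have h : F (π a x) = π a (F x) := congrArg (fun B : H →L[ℂ] H => B x) (hF a).eq
    have hx : F x = 0 := hx
    change F (π a x) = 0
    rw [h, hx, map_zero]
  rcases hπ.2 _ F.isClosed_ker hker with h | h
  · right
    ext x
    have hx : G x ∈ F.ker := congrArg (fun B : H →L[ℂ] H => B x) hFG
    rwa [h, Submodule.mem_bot] at hx
  · left
    ext x
    exact (h ▸ Submodule.mem_top : x ∈ F.ker)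

/-- Two distinct points of the spectrum are separated by continuous functions with product zero;
the functional calculus turns them into nonzero operators with product zero. -/
theorem exists_eq_algebraMap_of_commute_of_isIrreducible (hπ : IsIrreducible π) {B : H →L[ℂ] H}
    [IsStarNormal B] (hB : ∀ a, Commute B (π a)) : ∃ c, B = algebraMap ℂ (H →L[ℂ] H) c := by
  have hB' (a : A) : Commute (star B) (π a) := by
    simpa [map_star] using (hB (star a)).star_star
  have : Nontrivial H := hπ.1
  obtain ⟨c, hc⟩ := spectrum.nonempty B
  refine ⟨c, CFC.eq_algebraMap_of_spectrum_subset_singleton B c fun d hd => ?_⟩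
  by_contra hdc
  let f : ℂ → ℂ := fun z => (max 0 (dist z d - dist z c) : ℝ)
  let g : ℂ → ℂ := fun z => (max 0 (dist z c - dist z d) : ℝ)
  have hf : Continuous f := by fun_prop
  have hg : Continuous g := by fun_prop
  have hfg (z : ℂ) : f z * g z = 0 := by
    rcases le_total (dist z d) (dist z c) with h | h
    · simp [f, h]
    · simp [g, h]
  have cfc_ne_zero {k : ℂ → ℂ} {e : ℂ} (hk : Continuous k) (he : e ∈ spectrum ℂ B)
      (hke : k e ≠ 0) : cfc k B ≠ 0 := fun h => hke <|
    eqOn_of_cfc_eq_cfc (h.trans (cfc_zero ℂ B).symm) hk.continuousOn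
      continuous_zero.continuousOn ‹_› he
  have hmul : cfc f B * cfc g B = 0 := by
    rw [← cfc_mul f g B hf.continuousOn hg.continuousOn, funext hfg]
    exact cfc_const_zero ℂ B
  rcases eq_zero_or_eq_zero_of_mul_eq_zero_of_isIrreducible hπ
    (fun a => (hB a).cfc (hB' a) f) hmul with h | h
  · exact cfc_ne_zero hf hc (by simpa [f] using dist_pos.mpr (Ne.symm hdc)) h
  · exact cfc_ne_zero hg hd (by simpa [g] using dist_pos.mpr hdc) h

end Schur

section BasisSpan

open Rep

variable {H : Type v} [NormedAddCommGroup H] [InnerProductSpace ℂ H] [CompleteSpace H]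
  {b : HilbertBasis ℕ ℂ H}

variable (b) in
/-- The vectors of a Hilbert basis with index in `I`, as a Hilbert basis of their closed span. -/
noncomputable def subBasis (I : Set ℕ) : HilbertBasis I ℂ (basisSpan b I) :=
  HilbertBasis.mkOfOrthogonalEqBot
    (v := fun n : I => (⟨b n, hilbertBasis_mem_closure_span_iff.mpr n.2⟩ : basisSpan b I))
    (((basisSpan b I).subtypeₗᵢ.orthonormal_comp_iff).mp
      (b.orthonormal.comp _ Subtype.val_injective)) <| by
      refine (Submodule.eq_bot_iff _).mpr fun x hx => Subtype.ext ?_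
      refine eq_zero_of_forall_inner_hilbertBasis_eq_zero (b := b) fun n => ?_
      by_cases hn : n ∈ I
      · exact hx _ (Submodule.subset_span ⟨⟨n, hn⟩, rfl⟩)
      · exact inner_hilbertBasis_eq_zero_of_mem_closure_span hn x.2

@[simp] theorem coe_subBasis_apply (I : Set ℕ) (n : I) : (subBasis b I n : H) = b n :=
  congrArg Subtype.val (congrFun (HilbertBasis.coe_mkOfOrthogonalEqBot _ _) n)

theorem isHilbertSum_basisSpan_iff {J : Type*} {I : J → Set ℕ} :
    IsHilbertSum ℂ (fun j => basisSpan b (I j)) (fun j => (basisSpan b (I j)).subtypeₗᵢ) ↔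
      Pairwise (fun j k => Disjoint (I j) (I k)) ∧ ∀ n, ∃ j, n ∈ I j := by
  refine ⟨fun h => ⟨fun j k hjk => ?_, fun n => ?_⟩, fun ⟨hd, hc⟩ => ?_⟩
  · refine Set.disjoint_left.mpr fun n hj hk => ?_
    have h := h.OrthogonalFamily hjk ⟨b n, hilbertBasis_mem_closure_span_iff.mpr hj⟩
      ⟨b n, hilbertBasis_mem_closure_span_iff.mpr hk⟩
    exact b.orthonormal.ne_zero n (inner_self_eq_zero.mp h)
  · by_contra! hn
    obtain ⟨f, hf⟩ := h.surjective_isometry (b n)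
    have hsum := (hf ▸ h.OrthogonalFamily.hasSum_linearIsometry f).mapL (innerSL ℂ (b n))
    have hzero (j : J) : innerSL ℂ (b n) ((basisSpan b (I j)).subtypeₗᵢ (f j)) = 0 :=
      inner_hilbertBasis_eq_zero_of_mem_closure_span (hn j) (f j).2
    simp only [hzero] at hsum
    exact b.orthonormal.ne_zero n (inner_self_eq_zero.mp (hsum.unique hasSum_zero))
  · refine IsHilbertSum.mkInternal _ (fun j k hjk x y => ?_) ?_
    · have h : basisSpan b (I j) ≤ (basisSpan b (I k))ᗮ :=
        closure_span_hilbertBasis_le (Submodule.isClosed_orthogonal _) fun n hn =>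
          (Submodule.mem_orthogonal' _ _).mpr fun z hz =>
            inner_hilbertBasis_eq_zero_of_mem_closure_span (Set.disjoint_left.mp (hd hjk) hn) hz
      exact (Submodule.mem_orthogonal' _ _).mp (h x.2) _ y.2
    · rw [← b.dense_span]
      refine Submodule.topologicalClosure_mono (Submodule.span_le.mpr ?_)
      rintro _ ⟨n, rfl⟩
      obtain ⟨j, hj⟩ := hc n
      exact Submodule.mem_iSup_of_mem j (hilbertBasis_mem_closure_span_iff.mpr hj)

end BasisSpan

/-! ### Representations of the 2-adic ring C*-algebra -/

section

open TwoAdicRingAlgebra Rep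

variable {ι κ : Type*}
  {H : Type u} [NormedAddCommGroup H] [InnerProductSpace ℂ H] [CompleteSpace H]
  {K : Type u} [NormedAddCommGroup K] [InnerProductSpace ℂ K] [CompleteSpace K]
  {π : TwoAdicRingAlgebra.{u} →⋆ₐ[ℂ] (H →L[ℂ] H)} {b : HilbertBasis ι ℂ H}
  {π' : TwoAdicRingAlgebra.{u} →⋆ₐ[ℂ] (K →L[ℂ] K)} {b' : HilbertBasis κ ℂ K}
  {T : TwoAdicSystem ι} {T' : TwoAdicSystem κ}

namespace TwoAdicRingAlgebra

theorem map_relations (π : TwoAdicRingAlgebra.{u} →⋆ₐ[ℂ] (H →L[ℂ] H)) :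
    TwoAdicRelations (H →L[ℂ] H) (π U) (π S₂) where
  star_U_mul := by simpa [map_star] using congrArg π relations.star_U_mul
  U_mul_star := by simpa [map_star] using congrArg π relations.U_mul_star
  isometry := by simpa [map_star] using congrArg π relations.isometry
  comm := by simpa using congrArg π relations.comm
  sum := by simpa [map_star] using congrArg π relations.sum

theorem intertwines_of_generators {V : H ≃ₗᵢ[ℂ] K} (hU : ∀ n, V (π U (b n)) = π' U (V (b n)))
    (hS : ∀ n, V (π S₂ (b n)) = π' S₂ (V (b n))) (a : TwoAdicRingAlgebra.{u}) (x : H) :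
    V (π a x) = π' a (V x) := by
  let φ : TwoAdicRingAlgebra.{u} →⋆ₐ[ℂ] (K →L[ℂ] K) := V.conjStarAlgEquiv.toStarAlgHom.comp π
  have φ_apply (c : TwoAdicRingAlgebra.{u}) (y : K) : φ c y = V (π c (V.symm y)) := rfl
  have φ_eq {c : TwoAdicRingAlgebra.{u}} (hc : ∀ n, V (π c (b n)) = π' c (V (b n))) :
      φ c = π' c := by
    have h : (V : H →L[ℂ] K) ∘L π c = π' c ∘L (V : H →L[ℂ] K) :=
      continuousLinearMap_ext_hilbertBasis b hc
    ext y
    simpa [φ_apply] using congrArg (fun F : H →L[ℂ] K => F (V.symm y)) h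
  have hφ : φ = π' :=
    (existsUnique_hom (map_relations π')).unique ⟨φ_eq hU, φ_eq hS⟩ ⟨rfl, rfl⟩
  rw [← hφ, φ_apply, V.symm_apply_apply]

end TwoAdicRingAlgebra

namespace TwoAdicSystem

/-- The generators of `Q₂` permute the vectors of the Hilbert basis `b` according to the system
`T`, that is, `π` is permutative with `σ₂ = T.σ` and `τ = T.τ`; any index type is allowed. -/
structure Implements (T : TwoAdicSystem ι) (π : TwoAdicRingAlgebra.{u} →⋆ₐ[ℂ] (H →L[ℂ] H))
    (b : HilbertBasis ι ℂ H) : Prop where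
  map_S₂ : ∀ n, π S₂ (b n) = b (T.σ n)
  map_U : ∀ n, π U (b n) = b (T.τ n)

namespace Implements

theorem star_U (hT : T.Implements π b) (n : ι) : π (star U) (b (T.τ n)) = b n := by
  rw [map_star]
  exact star_hilbertBasis_of_injective hT.map_U T.τ.injective n

theorem star_S₂ (hT : T.Implements π b) (n : ι) : π (star S₂) (b (T.σ n)) = b n := by
  rw [map_star]
  exact star_hilbertBasis_of_injective hT.map_S₂ T.σ_injective n

theorem invariant_of_isInvariant (hT : T.Implements π b) {M : Submodule ℂ H}
    (hM : IsInvariant π M) : T.Invariant {n | b n ∈ M} where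
  τ_mem n := by
    simp only [Set.mem_ofPred_eq]
    exact ⟨fun h => hT.star_U n ▸ hM (star U) _ h, fun h => hT.map_U n ▸ hM U _ h⟩
  σ_mem n := by
    simp only [Set.mem_ofPred_eq]
    exact ⟨fun h => hT.star_S₂ n ▸ hM (star S₂) _ h, fun h => hT.map_S₂ n ▸ hM S₂ _ h⟩

/-- The reflection in the subspace commutes with the generators, hence with `π`. -/
theorem isInvariant_closure_span (hT : T.Implements π b) {I : Set ι} (hI : T.Invariant I) :
    IsInvariant π (Submodule.span ℂ (b '' I)).topologicalClosure := by
  set M := (Submodule.span ℂ (b '' I)).topologicalClosure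
  have reflection_of_mem {n : ι} (hn : n ∈ I) : M.reflection (b n) = b n :=
    Submodule.reflection_mem_subspace_eq_self (hilbertBasis_mem_closure_span_iff.mpr hn)
  have reflection_of_notMem {n : ι} (hn : n ∉ I) : M.reflection (b n) = -b n :=
    Submodule.reflection_mem_subspace_orthogonalComplement_eq_neg
      ((Submodule.mem_orthogonal' _ _).mpr fun _ hx =>
        inner_hilbertBasis_eq_zero_of_mem_closure_span hn hx)
  have commute_of_basis {a : TwoAdicRingAlgebra.{u}} {f : ι → ι} (ha : ∀ n, π a (b n) = b (f n))
      (hf : ∀ n, f n ∈ I ↔ n ∈ I) (n : ι) :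
      M.reflection (π a (b n)) = π a (M.reflection (b n)) := by
    by_cases hn : n ∈ I
    · rw [ha, reflection_of_mem hn, reflection_of_mem ((hf n).mpr hn), ha]
    · rw [ha, reflection_of_notMem hn, reflection_of_notMem ((hf n).not.mpr hn), map_neg, ha]
  intro a x hx
  have h := intertwines_of_generators (commute_of_basis hT.map_U hI.τ_mem)
    (commute_of_basis hT.map_S₂ hI.σ_mem) a x
  rw [Submodule.reflection_mem_subspace_eq_self hx] at h
  exact (Submodule.reflection_eq_self_iff _).mp h

theorem hilbertBasisEquiv_intertwines (hT : T.Implements π b) (hT' : T'.Implements π' b')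
    {e : ι ≃ κ} (hσ : Function.Semiconj e T.σ T'.σ) (hτ : Function.Semiconj e T.τ T'.τ)
    (a : TwoAdicRingAlgebra.{u}) (x : H) :
    hilbertBasisEquiv b b' e (π a x) = π' a (hilbertBasisEquiv b b' e x) :=
  intertwines_of_generators
    (fun n => by
      rw [hT.map_U, hilbertBasisEquiv_apply, hilbertBasisEquiv_apply, hT'.map_U, hτ.eq])
    (fun n => by
      rw [hT.map_S₂, hilbertBasisEquiv_apply, hilbertBasisEquiv_apply, hT'.map_S₂, hσ.eq]) a x

end Implements

end TwoAdicSystem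

/-! ### Cylinder projections -/

namespace TwoAdicRingAlgebra

/-- The range projection of `U ^ r * S₂ ^ k`: in a permutative representation, the projection onto
the basis vectors whose code lies in the cylinder `r + 2 ^ k * ℤ₂`. -/
noncomputable def cylinderProjection (k r : ℕ) : TwoAdicRingAlgebra.{u} :=
  U ^ r * S₂ ^ k * star (U ^ r * S₂ ^ k)

theorem star_cylinderProjection (k r : ℕ) :
    star (cylinderProjection.{u} k r) = cylinderProjection k r := by
  rw [cylinderProjection, star_mul, star_star]

end TwoAdicRingAlgebra

namespace TwoAdicSystem

namespace Implements

theorem map_U_pow_mul_S₂_pow (hT : T.Implements π b) (r k : ℕ) (n : ι) :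
    π (U ^ r * S₂ ^ k) (b n) = b ((T.τ ^ (r : ℤ)) (T.σ^[k] n)) := by
  have map_S₂_pow : π (S₂ ^ k) (b n) = b (T.σ^[k] n) := by
    induction k with
    | zero => simp
    | succ k ih =>
      rw [pow_succ', map_mul, mul_apply_eq_comp, ih, hT.map_S₂,
        Function.iterate_succ_apply']
  have map_U_pow (n : ι) : π (U ^ r) (b n) = b ((T.τ ^ (r : ℤ)) n) := by
    induction r with
    | zero => simp
    | succ r ih =>
      rw [pow_succ', map_mul, mul_apply_eq_comp, ih, hT.map_U, zpow_natCast,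
        zpow_natCast, pow_succ', Equiv.Perm.mul_apply]
  rw [map_mul, mul_apply_eq_comp, map_S₂_pow, map_U_pow]

theorem map_cylinderProjection_of_dvd (hT : T.Implements π b) {k r : ℕ} {n : ι}
    (h : 2 ^ k ∣ T.code n - r) : π (cylinderProjection k r) (b n) = b n := by
  obtain ⟨m, rfl⟩ := (T.mem_range_zpow_iterate_iff (r := r)).mpr (by exact_mod_cast h)
  rw [cylinderProjection, map_mul, map_star, mul_apply_eq_comp,
    star_hilbertBasis_of_injective (hT.map_U_pow_mul_S₂_pow r k)
      ((T.τ ^ (r : ℤ)).injective.comp (T.σ_injective.iterate k)), hT.map_U_pow_mul_S₂_pow]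

theorem map_cylinderProjection_of_not_dvd (hT : T.Implements π b) {k r : ℕ} {n : ι}
    (h : ¬2 ^ k ∣ T.code n - r) : π (cylinderProjection k r) (b n) = 0 := by
  have hn : n ∉ Set.range fun m => (T.τ ^ (r : ℤ)) (T.σ^[k] m) := fun ⟨m, hm⟩ =>
    h (by exact_mod_cast T.mem_range_zpow_iterate_iff.mp ⟨m, hm.symm⟩)
  rw [cylinderProjection, map_mul, map_star, mul_apply_eq_comp,
    star_hilbertBasis_of_notMem_range (hT.map_U_pow_mul_S₂_pow r k) hn, map_zero]

theorem inner_eq_zero_of_code_ne (hT : T.Implements π b) (hT' : T'.Implements π' b') {n : ι}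
    {x : K} (hx : ∀ a, π a (b n) = b n → π' a x = x) {m : κ} (hm : T'.code m ≠ T.code n) :
    inner ℂ (b' m) x = 0 := by
  obtain ⟨k, hk⟩ : ∃ k, ¬2 ^ k ∣ T'.code m - T.code n := by
    contrapose! hm
    exact eq_of_forall_pow_dvd_sub not_isUnit_two_padicInt hm
  set r := (T.code n).appr k
  have hr : 2 ^ k ∣ T.code n - r := by
    exact_mod_cast Ideal.mem_span_singleton.mp (PadicInt.appr_spec k (T.code n))
  have hmr : ¬2 ^ k ∣ T'.code m - r := fun h =>
    hk ((sub_sub_sub_cancel_right (T'.code m) (T.code n) r) ▸ dvd_sub h hr)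
  rw [← hx _ (hT.map_cylinderProjection_of_dvd hr), ← star_cylinderProjection, map_star,
    ContinuousLinearMap.star_eq_adjoint, ContinuousLinearMap.adjoint_inner_right,
    hT'.map_cylinderProjection_of_not_dvd hmr, inner_zero_left]

/-! ### Irreducibility and equivalence -/

theorem isIrreducible_of_connected (hT : T.Implements π b) [Nonempty ι]
    (hconn : ∀ m n, T.Connected m n) (hinj : Function.Injective T.code) : IsIrreducible π := by
  obtain ⟨n₀⟩ := ‹Nonempty ι›
  refine ⟨⟨b n₀, 0, b.orthonormal.ne_zero n₀⟩, fun M hMc hM => ?_⟩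
  have : CompleteSpace M := hMc.completeSpace_coe
  by_cases hex : ∃ n, b n ∈ M
  · obtain ⟨n, hn⟩ := hex
    have hall (m : ι) : b m ∈ M :=
      ((hT.invariant_of_isInvariant hM).mem_iff_of_connected (hconn n m)).mp hn
    right
    rw [eq_top_iff, ← b.dense_span]
    exact Submodule.topologicalClosure_minimal _
      (Submodule.span_le.mpr (Set.forall_mem_range.mpr hall)) hMc
  · push Not at hex
    have projection_eq_smul (n : ι) :
        M.starProjection (b n) = inner ℂ (b n) (M.starProjection (b n)) • b n :=
      eq_smul_of_forall_ne_inner_hilbertBasis_eq_zero fun m hm =>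
        hT.inner_eq_zero_of_code_ne hT
          (fun a ha => by rw [← starProjection_apply_of_isInvariant hM, ha]) (hinj.ne hm)
    have projection_eq_zero : M.starProjection = 0 :=
      continuousLinearMap_ext_hilbertBasis b fun n => by
        by_contra hne
        have hmem := projection_eq_smul n ▸ M.starProjection_apply_mem (b n)
        rw [projection_eq_smul] at hne
        exact hex n ((M.smul_mem_iff (left_ne_zero_of_smul hne)).mp hmem)
    left
    refine (Submodule.eq_bot_iff M).mpr fun x hx => ?_
    rw [← Submodule.starProjection_eq_self_iff.mpr hx, projection_eq_zero]
    rfl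

theorem connected_of_isIrreducible (hT : T.Implements π b) (hπ : IsIrreducible π) (m n : ι) :
    T.Connected m n := by
  rcases hπ.2 _ (Submodule.isClosed_topologicalClosure _)
    (hT.isInvariant_closure_span (invariant_setOf_connected m)) with h | h
  · have hm := (hilbertBasis_mem_closure_span_iff (b := b) (I := {n | T.Connected m n})).mpr
      (Connected.refl m)
    rw [h, Submodule.mem_bot] at hm
    exact absurd hm (b.orthonormal.ne_zero m)
  · exact (hilbertBasis_mem_closure_span_iff (b := b) (I := {n | T.Connected m n})).mp
      (h ▸ Submodule.mem_top)

/-- Two basis vectors with the same code are exchanged by a unitary in the commutant, which Schur's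
lemma forces to be a scalar. -/
theorem code_injective_of_isIrreducible (hT : T.Implements π b) (hπ : IsIrreducible π) :
    Function.Injective T.code := by
  intro m n hmn
  obtain ⟨θ, hσ, hτ, rfl⟩ := exists_equivariant_perm (hT.connected_of_isIrreducible hπ) hmn
  set W := hilbertBasisEquiv b b θ with hW
  have : IsStarNormal (W : H →L[ℂ] H) :=
    inferInstanceAs (IsStarNormal ((Unitary.linearIsometryEquiv.symm W : unitary _) : H →L[ℂ] H))
  have hcomm (a : TwoAdicRingAlgebra.{u}) : Commute (W : H →L[ℂ] H) (π a) :=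
    ContinuousLinearMap.ext (hT.hilbertBasisEquiv_intertwines hT hσ hτ a)
  obtain ⟨c, hc⟩ := exists_eq_algebraMap_of_commute_of_isIrreducible hπ hcomm
  have hθ : b (θ m) = c • b m := by
    rw [← hilbertBasisEquiv_apply b b, ← hW]
    simpa [Algebra.algebraMap_eq_smul_one] using congrArg (fun F : H →L[ℂ] H => F (b m)) hc
  by_contra hne
  have h : inner ℂ (b (θ m)) (b (θ m)) = c * inner ℂ (b (θ m)) (b m) := by
    conv_lhs => rw [hθ, inner_smul_right, ← hθ]
  rw [b.orthonormal.2 (Ne.symm hne), mul_zero] at h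
  exact b.orthonormal.ne_zero _ (inner_self_eq_zero.mp h)

theorem isIrreducible_iff (hT : T.Implements π b) : IsIrreducible π ↔
    Nonempty ι ∧ (∀ m n, T.Connected m n) ∧ Function.Injective T.code := by
  refine ⟨fun h => ⟨?_, hT.connected_of_isIrreducible h, hT.code_injective_of_isIrreducible h⟩,
    fun ⟨_, hconn, hinj⟩ => hT.isIrreducible_of_connected hconn hinj⟩
  obtain ⟨x, hx⟩ := @exists_ne H h.1 0
  by_contra hι
  rw [not_nonempty_iff] at hι
  exact hx (eq_zero_of_forall_inner_hilbertBasis_eq_zero (b := b) isEmptyElim)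

theorem unitarilyEquivalent_iff (hT : T.Implements π b) (hT' : T'.Implements π' b')
    (hπ : IsIrreducible π) (hπ' : IsIrreducible π') :
    UnitarilyEquivalent π π' ↔ ∃ m n, T.code m = T'.code n := by
  obtain ⟨⟨m₀⟩, hconn, hinj⟩ := hT.isIrreducible_iff.mp hπ
  obtain ⟨-, hconn', hinj'⟩ := hT'.isIrreducible_iff.mp hπ'
  constructor
  · rintro ⟨V, hV⟩
    by_contra! hne
    have hzero : V (b m₀) = 0 := eq_zero_of_forall_inner_hilbertBasis_eq_zero fun n =>
      hT.inner_eq_zero_of_code_ne hT' (fun a ha => by rw [← hV, ha]) (hne m₀ n).symm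
    exact b.orthonormal.ne_zero m₀ ((map_eq_zero_iff V V.injective).mp hzero)
  · rintro ⟨m, n, hmn⟩
    obtain ⟨e, hσ, hτ⟩ := exists_equivariant_equiv hconn hconn' hinj hinj' hmn
    exact ⟨hilbertBasisEquiv b b' e, hT.hilbertBasisEquiv_intertwines hT' hσ hτ⟩

end Implements

end TwoAdicSystem

end

/-! ### Permutative representations -/

section

open TwoAdicRingAlgebra Rep

variable {H : Type u} [NormedAddCommGroup H] [InnerProductSpace ℂ H] [CompleteSpace H]
  {ρ : TwoAdicRingAlgebra.{u} →⋆ₐ[ℂ] (H →L[ℂ] H)} {b : HilbertBasis ℕ ℂ H}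
  {T : TwoAdicSystem ℕ} {J : Type} {I : J → Set ℕ}

theorem TwoAdicRingAlgebra.IsPermutative.exists_implements (h : IsPermutative ρ b) :
    ∃ T : TwoAdicSystem ℕ, T.Implements ρ b := by
  obtain ⟨σ, τ, hσ, h⟩ := h
  have hS (n : ℕ) : ρ S₂ (b n) = b (σ n) := (h n).1
  have hU (n : ℕ) : ρ U (b n) = b (τ n) := (h n).2
  have hrel := map_relations ρ
  have hSS (n : ℕ) : star (ρ S₂) (b (σ n)) = b n := star_hilbertBasis_of_injective hS hσ n
  have hUU (n : ℕ) : star (ρ U) (b (τ n)) = b n := star_hilbertBasis_of_injective hU τ.injective n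
  have hcomm (x : H) : ρ S₂ (ρ U x) = ρ U (ρ U (ρ S₂ x)) := by
    have h := congrArg (fun F : H →L[ℂ] H => F x) hrel.comm
    rwa [pow_two] at h
  have hsum (x : H) : ρ S₂ (star (ρ S₂) x) + ρ U (ρ S₂ (star (ρ S₂) (star (ρ U) x))) = x :=
    congrArg (fun F : H →L[ℂ] H => F x) hrel.sum
  refine ⟨⟨σ, τ, hσ, fun n => ?_, fun m n hmn => ?_, fun n => ?_⟩, hS, hU⟩
  · apply hilbertBasis_injective b
    rw [← hS, ← hU, hcomm, hS, hU, hU]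
  · have h := hsum (b (σ m))
    rw [hSS, hS, hmn, hUU, hSS, hS, hU] at h
    exact b.orthonormal.ne_zero _ (left_eq_add.mp h.symm)
  · by_contra! hn
    obtain ⟨l, rfl⟩ := τ.surjective n
    have h := hsum (b (τ l))
    rw [hUU, star_hilbertBasis_of_notMem_range hS fun ⟨m, hm⟩ => (hn m).1 hm.symm,
      star_hilbertBasis_of_notMem_range hS fun ⟨m, hm⟩ => (hn m).2 (congrArg τ hm.symm)] at h
    simp only [map_zero, add_zero] at h
    exact b.orthonormal.ne_zero _ h.symm

namespace TwoAdicSystem.Implements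

theorem isInvariant_basisSpan_iff (hT : T.Implements ρ b) {I : Set ℕ} :
    IsInvariant ρ (basisSpan b I) ↔ T.Invariant I := by
  refine ⟨fun h => ?_, hT.isInvariant_closure_span⟩
  have hI : {n | b n ∈ basisSpan b I} = I := Set.ext fun _ => hilbertBasis_mem_closure_span_iff
  exact hI ▸ hT.invariant_of_isInvariant h

theorem subrep (hT : T.Implements ρ b) {I : Set ℕ} (hI : T.Invariant I)
    (hM : IsInvariant ρ (basisSpan b I)) :
    (T.restrict hI).Implements (Rep.subrep ρ (basisSpan b I) hM) (subBasis b I) where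
  map_S₂ n := Subtype.ext <| by
    change ρ S₂ (subBasis b I n : H) = _
    rw [coe_subBasis_apply, hT.map_S₂, coe_subBasis_apply]
    rfl
  map_U n := Subtype.ext <| by
    change ρ U (subBasis b I n : H) = _
    rw [coe_subBasis_apply, hT.map_U, coe_subBasis_apply]
    rfl

theorem isIrreducible_subrep_iff (hT : T.Implements ρ b) {I : Set ℕ}
    (hM : IsInvariant ρ (basisSpan b I)) : IsIrreducible (Rep.subrep ρ (basisSpan b I) hM) ↔
      I.Nonempty ∧ (∀ m ∈ I, ∀ n ∈ I, T.Connected m n) ∧ Set.InjOn T.code I := by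
  have hI := hT.isInvariant_basisSpan_iff.mp hM
  have hcode : (T.restrict hI).code = I.domRestrict T.code := funext (code_restrict hI)
  rw [(hT.subrep hI hM).isIrreducible_iff, Set.nonempty_coe_sort, hcode, Set.injOn_iff_injective]
  simp only [connected_restrict_iff, Subtype.forall]

theorem isIrreducibleDecomposition_iff (hT : T.Implements ρ b) :
    IsIrreducibleDecomposition ρ b I ↔
      (∀ j, T.Invariant (I j)) ∧
      (∀ j, (I j).Nonempty ∧ (∀ m ∈ I j, ∀ n ∈ I j, T.Connected m n) ∧ Set.InjOn T.code (I j)) ∧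
      Pairwise (fun j k => Disjoint (I j) (I k)) ∧ ∀ n, ∃ j, n ∈ I j := by
  refine ⟨fun h => ⟨fun j => hT.isInvariant_basisSpan_iff.mp (h.invariant j),
    fun j => (hT.isIrreducible_subrep_iff (h.invariant j)).mp (h.irreducible j),
    isHilbertSum_basisSpan_iff.mp h.hilbertSum⟩, fun ⟨hinv, hirr, hsum⟩ => ?_⟩
  have hM (j : J) := hT.isInvariant_basisSpan_iff.mpr (hinv j)
  exact ⟨hM, fun j => (hT.isIrreducible_subrep_iff (hM j)).mpr (hirr j),
    isHilbertSum_basisSpan_iff.mpr hsum⟩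

theorem unitarilyEquivalent_subrep_iff (hT : T.Implements ρ b)
    (h : IsIrreducibleDecomposition ρ b I) (j k : J) :
    UnitarilyEquivalent (Rep.subrep ρ (basisSpan b (I j)) (h.invariant j))
      (Rep.subrep ρ (basisSpan b (I k)) (h.invariant k)) ↔
      ∃ m ∈ I j, ∃ n ∈ I k, T.code m = T.code n := by
  have hI := (hT.isIrreducibleDecomposition_iff.mp h).1
  rw [(hT.subrep (hI j) (h.invariant j)).unitarilyEquivalent_iff
    (hT.subrep (hI k) (h.invariant k)) (h.irreducible j) (h.irreducible k)]
  simp only [code_restrict, Subtype.exists, exists_prop]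

/-! ### Decompositions -/

theorem eq_of_connected_of_isIrreducibleDecomposition (hT : T.Implements ρ b)
    (h : IsIrreducibleDecomposition ρ b I) {m n : ℕ} (hmn : T.Connected m n)
    (hcode : T.code m = T.code n) : m = n := by
  obtain ⟨hinv, hirr, -, hcover⟩ := hT.isIrreducibleDecomposition_iff.mp h
  obtain ⟨j, hm⟩ := hcover m
  exact (hirr j).2.2 hm (((hinv j).mem_iff_of_connected hmn).mp hm) hcode

theorem isIrreducibleDecomposition_orbits (hT : T.Implements ρ b)
    (h : ∀ m n, T.Connected m n → T.code m = T.code n → m = n) :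
    IsIrreducibleDecomposition ρ b
      fun j : Quotient T.orbitSetoid => {n | Quotient.mk T.orbitSetoid n = j} := by
  have connected_of_mem {j : Quotient T.orbitSetoid} {m n : ℕ}
      (hm : Quotient.mk T.orbitSetoid m = j) (hn : Quotient.mk T.orbitSetoid n = j) :
      T.Connected m n := Quotient.exact (hm.trans hn.symm)
  refine hT.isIrreducibleDecomposition_iff.mpr
    ⟨fun j => ?_, fun j => ⟨j.exists_rep, ?_, ?_⟩, ?_, ?_⟩
  · obtain ⟨m, rfl⟩ := j.exists_rep
    have horbit : {n | Quotient.mk T.orbitSetoid n = Quotient.mk T.orbitSetoid m} =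
        {n | T.Connected m n} := Set.ext fun n => eq_comm.trans Quotient.eq
    exact horbit ▸ invariant_setOf_connected m
  · exact fun m hm n hn => connected_of_mem hm hn
  · exact fun m hm n hn => h m n (connected_of_mem hm hn)
  · exact fun j k hjk => Set.disjoint_left.mpr fun n hj hk => hjk (hj.symm.trans hk)
  · exact fun n => ⟨_, rfl⟩

theorem decomposesIntoIrreducibles_iff (hT : T.Implements ρ b) :
    DecomposesIntoIrreducibles ρ b ↔ ∀ m n, T.Connected m n → T.code m = T.code n → m = n :=
  ⟨fun ⟨_, _, h⟩ _ _ => hT.eq_of_connected_of_isIrreducibleDecomposition h,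
    fun h => ⟨_, _, hT.isIrreducibleDecomposition_orbits h⟩⟩

theorem decomposesIntoDistinctIrreducibles_iff (hT : T.Implements ρ b) :
    DecomposesIntoDistinctIrreducibles ρ b ↔ Function.Injective T.code := by
  constructor
  · rintro ⟨J, I, h, hne⟩ m n hmn
    obtain ⟨-, hirr, -, hcover⟩ := hT.isIrreducibleDecomposition_iff.mp h
    obtain ⟨j, hm⟩ := hcover m
    obtain ⟨k, hn⟩ := hcover n
    obtain rfl : j = k := by
      by_contra hjk
      exact hne j k hjk ((hT.unitarilyEquivalent_subrep_iff h j k).mpr ⟨m, hm, n, hn, hmn⟩)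
    exact (hirr j).2.2 hm hn hmn
  · intro hinj
    have h := hT.isIrreducibleDecomposition_orbits fun m n _ hmn => hinj hmn
    refine ⟨_, _, h, fun j k hjk heq => hjk ?_⟩
    obtain ⟨m, hm, n, hn, hmn⟩ := (hT.unitarilyEquivalent_subrep_iff h j k).mp heq
    exact hm.symm.trans (hinj hmn ▸ hn)

/-! ### Restriction to the Cuntz algebra -/

theorem isImplementedBy_iff (hT : T.Implements ρ b) {s : BranchingSystem} :
    CuntzAlgebra.IsImplementedBy (CuntzAlgebra.restrict ρ) b s ↔ s = T.branching := by
  have map_X₁ (n : ℕ) :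
      CuntzAlgebra.restrict ρ CuntzAlgebra.X₁ (b n) = b (T.branching.map 0 n) := by
    change ρ (CuntzAlgebra.toTwoAdic CuntzAlgebra.X₁) (b n) = b (T.τ (T.σ n))
    rw [CuntzAlgebra.toTwoAdic_X₁, map_mul, mul_apply_eq_comp, hT.map_S₂, hT.map_U]
  have map_X₂ (n : ℕ) :
      CuntzAlgebra.restrict ρ CuntzAlgebra.X₂ (b n) = b (T.branching.map 1 n) := by
    change ρ (CuntzAlgebra.toTwoAdic CuntzAlgebra.X₂) (b n) = b (T.σ n)
    rw [CuntzAlgebra.toTwoAdic_X₂, hT.map_S₂]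
  refine ⟨fun hs => ?_, fun hs n => hs ▸ ⟨map_X₁ n, map_X₂ n⟩⟩
  have hmap : s.map = T.branching.map := by
    funext i n
    apply hilbertBasis_injective b
    fin_cases i
    · exact (hs n).1.symm.trans (map_X₁ n)
    · exact (hs n).2.symm.trans (map_X₂ n)
  cases s
  cases hB : T.branching
  simpa [hB] using hmap

theorem isRegular_iff (hT : T.Implements ρ b) : CuntzAlgebra.IsRegular (CuntzAlgebra.restrict ρ) b ↔
    ∀ m n, T.Connected m n → T.code m = T.code n → m = n := by
  simp only [CuntzAlgebra.IsRegular, hT.isImplementedBy_iff, exists_eq_left,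
    codingPartiallyInjective_iff]

theorem isMultiplicityFree_iff (hT : T.Implements ρ b) :
    CuntzAlgebra.IsMultiplicityFree (CuntzAlgebra.restrict ρ) b ↔ Function.Injective T.code := by
  simp only [CuntzAlgebra.IsMultiplicityFree, hT.isImplementedBy_iff, exists_eq_left,
    Function.Injective, coding_eq_coding_iff]

end TwoAdicSystem.Implements

end

theorem mainTheorem5 {H : Type u} [NormedAddCommGroup H] [InnerProductSpace ℂ H] [CompleteSpace H]
    (ρ : TwoAdicRingAlgebra.{u} →⋆ₐ[ℂ] (H →L[ℂ] H)) (b : HilbertBasis ℕ ℂ H)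
    (hρ : TwoAdicRingAlgebra.IsPermutative ρ b) :
    (CuntzAlgebra.IsRegular (CuntzAlgebra.restrict ρ) b ↔
      Rep.DecomposesIntoIrreducibles ρ b) ∧
    (CuntzAlgebra.IsMultiplicityFree (CuntzAlgebra.restrict ρ) b ↔
      Rep.DecomposesIntoDistinctIrreducibles ρ b) := by
  obtain ⟨T, hT⟩ := hρ.exists_implements
  exact ⟨hT.isRegular_iff.trans hT.decomposesIntoIrreducibles_iff.symm,
    hT.isMultiplicityFree_iff.trans hT.decomposesIntoDistinctIrreducibles_iff.symm⟩
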